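/- There exist absolute constants $c, C > 0$ such that the following holds. Let $n \ge 1$ be an integer, let $p$ be a prime with $2 < p \le \exp(c\,n^{1/4})$, let $\lambda \in \mathbb{F}_p$, and put $m = \lceil C \log p\rceil$. Let $M_n$ be the random symmetric $n \times n$ matrix whose entries on and above the diagonal are i.i.d. Rademacher random variables ($\pm 1$ with probability $1/2$ each), and regard $M_n - \lambda I_n$ as a matrix over $\mathbb{F}_p$. Then, with probability at least $1 - \exp(-n/9)$, every nonzero vector $v \in \mathbb{F}_p^n$ that is orthogonal to at least $n - n/\log p$ rows of $M_n - \lambda I_n$ has the following property: for every set $T \subseteq [n]$ of size at most $\lceil n/4 \rceil$ there are at least $n/(2m)$ pairwise disjoint sets $S \subseteq [n] \setminus T$ of size $m$ such that $$\operatorname{disc}_{\mathbb{F}_p}(v|_S) := \sup_{x \in \mathbb{F}_p} \left| \mathbb{P}_\xi\left[\sum_{i \in S} \xi_i v_i = x\right] - \frac1p \right| \le \frac{C}{p^2},$$ where $(\xi_i)_{i\in S}$ are i.i.d. Rademacher random variables. -/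

import Mathlib

namespace SymRademacher

/-- The probability of the event `E` for the uniform distribution on a finite sample space `Ω`.
On `ι → ℤˣ` this is the law of a family of i.i.d. Rademacher signs indexed by `ι`. -/
noncomputable def prob {Ω : Type*} [Fintype Ω] (E : Set Ω) : ℝ :=
  (E.ncard : ℝ) / (Fintype.card Ω : ℝ)

/-- The `n × n` symmetric Rademacher matrix, as a function of its signs `ω`: one sign for every
unordered pair `{i, j}` (with `i = j` allowed), that is for every entry on or above the
diagonal. -/
def radMatrix {n : ℕ} (ω : Sym2 (Fin n) → ℤˣ) : Matrix (Fin n) (Fin n) ℤ :=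
  Matrix.of fun i j => ((ω s(i, j) : ℤˣ) : ℤ)

/-- The matrix `M_n - a I_n` over `𝔽_p`. -/
def shiftedMatrix {n : ℕ} (p : ℕ) (a : ZMod p) (ω : Sym2 (Fin n) → ℤˣ) :
    Matrix (Fin n) (Fin n) (ZMod p) :=
  (radMatrix ω).map (fun z : ℤ => (z : ZMod p)) - a • (1 : Matrix (Fin n) (Fin n) (ZMod p))

/-- The discrepancy `sup_x |ℙ[∑ ξ_i w_i = x] - 1/p|` of a vector `w` over `𝔽_p`, where the `ξ_i`
are i.i.d. Rademacher signs. -/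
noncomputable def disc {p : ℕ} {ι : Type*} [Fintype ι] [DecidableEq ι] (w : ι → ZMod p) : ℝ :=
  ⨆ x : ZMod p, |prob {ξ : ι → ℤˣ | ∑ i, (((ξ i : ℤˣ) : ℤ) : ZMod p) * w i = x} - 1 / (p : ℝ)|

/-- The number of rows of `A` that are orthogonal to `v`. -/
noncomputable def orthRows {n p : ℕ} (A : Matrix (Fin n) (Fin n) (ZMod p))
    (v : Fin n → ZMod p) : ℕ :=
  {i : Fin n | A i ⬝ᵥ v = 0}.ncard

/-- For every `T ⊆ [n]` of size `n/4` (up to rounding in either direction; smaller sets are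
allowed as well) there are at least `n / (2m)` pairwise disjoint sets `S ⊆ [n] \ T` of size `m`
such that the restriction of `v` to `S` has discrepancy at most `C / p²`. -/
def ManyUniformBlocks {n p : ℕ} (C : ℝ) (m : ℕ) (v : Fin n → ZMod p) : Prop :=
  ∀ T : Finset (Fin n), T.card ≤ ⌈(n : ℝ) / 4⌉₊ →
    ∃ F : Finset (Finset (Fin n)),
      (n : ℝ) / (2 * (m : ℝ)) ≤ (F.card : ℝ) ∧
      (∀ S ∈ F, ∀ S' ∈ F, S ≠ S' → Disjoint S S') ∧
      ∀ S ∈ F, S.card = m ∧ Disjoint S T ∧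
        disc (fun i : S => v i) ≤ C / (p : ℝ) ^ 2

end SymRademacher

/-!
# Uniform blocks in vectors nearly annihilated by a random symmetric matrix

The proof is a union bound over the vectors `v` without many uniform blocks. Their number is
played off against the probability that `v` is orthogonal to almost all rows.

For a set `B` of coordinates let `h = excess v B` be the sum over frequencies `t ≠ 0` of
`∏_{i ∈ B} (3 + cos (4πt v_i / p)) / 4`. Every atom of the law of the Rademacher sum over `B` is
within `h / p` of `1 / p` (`abs_prob_sub_inv_le_excess`), so it is at most `f = (1 + h) / p`. The
entries in rows outside `B` and columns in `B` are independent signs, so all but `q` of the rows are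
orthogonal to `v` with probability at most about `2 ^ n * f ^ (n - q - |B|)`
(`prob_orthRows_ge_le`). With `q = ⌊n / log p⌋` and `|B| ≤ m`, where `m * log p` is much smaller
than `n`, this is at most `O(f) ^ n`, because `f ≥ 1 / p`.

Choose coordinates greedily from a set `D`, each lowering `h` by a fixed proportion
(`exists_greedy_subset`). Either `m` of them are found, and then `h ≤ 1 / p`; or every other
coordinate in `D` has its value in a set `A`, depending only on the restriction of `v` to the chosen
set `B`, of values that hardly change `h`. By the subadditivity of `1 - cos`, sumsets of `A` with up
to `2 ^ k` summands consist of values that change `h` by at most a constant proportion, and there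
are only `O(1 / f)` of these. Hence `|A| ≤ 1 + O(2 ^ (-k) / f)` by Cauchy–Davenport
(`card_nearValues_le`).

There are three kinds of vectors without many uniform blocks.
* Vectors supported on at most `m` coordinates. There are few of them, and each row is orthogonal
  to a given one with probability at most `1 / 2` (`sum_sparse_le`).
* Other vectors for which the greedy choice from all coordinates stops early. Here `A ≠ {0}`, so
  `|A| = O(2 ^ (-k) / f)`. The at most `p ^ m * |A| ^ n` such vectors for each `B` are
  outweighed by the probability `O(f) ^ n` (`sum_nearValues_le`).
* Vectors for which it does not stop early, so that `f ≤ 2 / p` for some `B`. A maximal family of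
  disjoint uniform blocks leaves a set `U` of at least `n / 5` coordinates without uniform blocks
  (`exists_large_set_of_not_manyUniformBlocks`). The greedy choice from `U` must stop early, as `m`
  chosen coordinates would form a uniform block. So almost all coordinates in `U` take one of
  `O(2 ^ (-k) * p)` values, and this saves a factor of about `2 ^ (-k * n / 5)` over the trivial
  count `p ^ n` (`sum_confined_le`).
-/

namespace SymRademacher

open Finset

/-! ### Fourier analysis of Rademacher sums over `ZMod p` -/

section

variable {p : ℕ} [Fact p.Prime]

/-- The real part `cos (2πx/p)` of the standard additive character of `ZMod p`. -/
noncomputable def cosChar (x : ZMod p) : ℝ := (ZMod.stdAddChar x).re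

lemma stdAddChar_neg_eq_conj (x : ZMod p) :
    ZMod.stdAddChar (-x) = (starRingEnd ℂ) (ZMod.stdAddChar x) := by
  rw [ZMod.stdAddChar_apply, ZMod.stdAddChar_apply, AddChar.map_neg_eq_inv, Circle.coe_inv_eq_conj]

lemma re_sq_add_im_sq_stdAddChar (x : ZMod p) :
    (ZMod.stdAddChar x).re ^ 2 + (ZMod.stdAddChar x).im ^ 2 = 1 := by
  have h : ‖ZMod.stdAddChar x‖ = 1 := by
    rw [ZMod.stdAddChar_apply]; exact Circle.norm_coe _
  have h2 := Complex.sq_norm (ZMod.stdAddChar x)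
  rw [h, Complex.normSq_apply] at h2
  linarith

@[simp] lemma cosChar_zero : cosChar (0 : ZMod p) = 1 := by
  simp [cosChar]

lemma cosChar_le_one (x : ZMod p) : cosChar x ≤ 1 := by
  have := re_sq_add_im_sq_stdAddChar x
  unfold cosChar
  nlinarith [sq_nonneg ((ZMod.stdAddChar x).im)]

lemma neg_one_le_cosChar (x : ZMod p) : -1 ≤ cosChar x := by
  have := re_sq_add_im_sq_stdAddChar x
  unfold cosChar
  nlinarith [sq_nonneg ((ZMod.stdAddChar x).im)]

lemma cosChar_add_add_cosChar_sub (x y : ZMod p) :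
    cosChar (x + y) + cosChar (x - y) = 2 * cosChar x * cosChar y := by
  unfold cosChar
  rw [sub_eq_add_neg, AddChar.map_add_eq_mul, AddChar.map_add_eq_mul, stdAddChar_neg_eq_conj]
  simp only [Complex.mul_re, Complex.conj_re, Complex.conj_im]
  ring

/-- The quadratic growth of `1 - cos` near `0` in subadditive form. -/
lemma one_sub_cosChar_add_le (x y : ZMod p) :
    1 - cosChar (x + y) ≤ 2 * (1 - cosChar x) + 2 * (1 - cosChar y) := by
  have hx := re_sq_add_im_sq_stdAddChar x
  have hy := re_sq_add_im_sq_stdAddChar y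
  unfold cosChar
  rw [AddChar.map_add_eq_mul, Complex.mul_re]
  nlinarith [sq_nonneg ((ZMod.stdAddChar x).re + (ZMod.stdAddChar y).re - 2),
    sq_nonneg ((ZMod.stdAddChar x).im - (ZMod.stdAddChar y).im)]

/-- `|cos θ| ≤ (1 + cos² θ) / 2 = (3 + cos 2θ) / 4`. -/
lemma abs_cosChar_le (x : ZMod p) : |cosChar x| ≤ (3 + cosChar (2 * x)) / 4 := by
  have h := cosChar_add_add_cosChar_sub x x
  rw [sub_self, cosChar_zero, ← two_mul] at h
  rw [abs_le]
  constructor <;> nlinarith [sq_nonneg (cosChar x + 1), sq_nonneg (cosChar x - 1)]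

lemma sum_stdAddChar_mul (u : ZMod p) :
    ∑ t : ZMod p, ZMod.stdAddChar (t * u) = if u = 0 then (p : ℂ) else 0 := by
  rw [AddChar.sum_mulShift u (ZMod.isPrimitive_stdAddChar p), ZMod.card]
  split_ifs <;> simp

lemma sum_cosChar_mul (u : ZMod p) :
    ∑ t : ZMod p, cosChar (t * u) = if u = 0 then (p : ℝ) else 0 := by
  have h := congrArg Complex.re (sum_stdAddChar_mul u)
  rw [Complex.re_sum] at h
  unfold cosChar
  rw [h]
  split_ifs <;> simp

lemma stdAddChar_sum {κ : Type*} (s : Finset κ) (f : κ → ZMod p) :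
    ZMod.stdAddChar (∑ i ∈ s, f i) = ∏ i ∈ s, ZMod.stdAddChar (f i) := by
  classical
  induction s using Finset.induction_on with
  | empty => simp
  | insert a s ha ih => rw [sum_insert ha, prod_insert ha, AddChar.map_add_eq_mul, ih]

lemma sum_units_stdAddChar (y : ZMod p) :
    ∑ e : ℤˣ, ZMod.stdAddChar ((((e : ℤˣ) : ℤ) : ZMod p) * y) = 2 * (cosChar y : ℂ) := by
  have hu : (univ : Finset ℤˣ) = {1, -1} := by decide
  rw [hu, sum_pair (by decide)]
  have : ((((-1 : ℤˣ) : ℤ) : ZMod p) * y) = -y := by simp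
  rw [this, stdAddChar_neg_eq_conj]
  simp only [Units.val_one, Int.cast_one, one_mul]
  rw [Complex.add_conj]
  simp [cosChar]

/-- Fourier inversion for the law of a Rademacher sum over `ZMod p`. -/
lemma prime_mul_ncard_signs {κ : Type*} [Fintype κ] [DecidableEq κ] (w : κ → ZMod p)
    (x : ZMod p) :
    (p : ℂ) * (({ξ : κ → ℤˣ | ∑ i, (((ξ i : ℤˣ) : ℤ) : ZMod p) * w i = x}.ncard : ℕ) : ℂ) =
      ∑ t : ZMod p, ZMod.stdAddChar (-(t * x)) * ∏ i, (2 * (cosChar (t * w i) : ℂ)) := by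
  have hprod : ∀ t : ZMod p, ∏ i, (2 * (cosChar (t * w i) : ℂ)) =
      ∑ ξ : κ → ℤˣ, ZMod.stdAddChar (t * ∑ i, (((ξ i : ℤˣ) : ℤ) : ZMod p) * w i) := by
    intro t
    simp_rw [← sum_units_stdAddChar]
    rw [Finset.prod_univ_sum]
    rw [Fintype.piFinset_univ]
    refine sum_congr rfl fun ξ _ => ?_
    rw [mul_sum, stdAddChar_sum]
    refine prod_congr rfl fun i _ => ?_
    congr 1
    ring
  simp_rw [hprod, mul_sum]
  rw [sum_comm]
  have hx : ∀ ξ : κ → ℤˣ, ∑ t : ZMod p, ZMod.stdAddChar (-(t * x)) *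
      ZMod.stdAddChar (t * ∑ i, (((ξ i : ℤˣ) : ℤ) : ZMod p) * w i) =
      if ∑ i, (((ξ i : ℤˣ) : ℤ) : ZMod p) * w i = x then (p : ℂ) else 0 := by
    intro ξ
    rw [← if_congr (sub_eq_zero (b := x)) rfl rfl, ← sum_stdAddChar_mul]
    refine sum_congr rfl fun t _ => ?_
    rw [← AddChar.map_add_eq_mul]
    congr 1
    ring
  simp_rw [mul_sum] at hx
  simp_rw [hx]
  rw [← sum_filter, sum_const, nsmul_eq_mul, mul_comm, Set.ncard_eq_toFinset_card']
  congr 3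
  ext ξ
  simp

lemma abs_prob_sub_inv_le {κ : Type*} [Fintype κ] [DecidableEq κ] (w : κ → ZMod p)
    (x : ZMod p) :
    |prob {ξ : κ → ℤˣ | ∑ i, (((ξ i : ℤˣ) : ℤ) : ZMod p) * w i = x} - 1 / (p : ℝ)| ≤
      (∑ t ∈ univ.erase (0 : ZMod p), ∏ i, |cosChar (t * w i)|) / p := by
  have hp : (0 : ℝ) < p := by exact_mod_cast (Fact.out : p.Prime).pos
  have hpc : (p : ℂ) ≠ 0 := by exact_mod_cast hp.ne'
  have h := prime_mul_ncard_signs w x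
  simp_rw [prod_mul_distrib, prod_const] at h
  rw [← add_sum_erase _ _ (mem_univ (0 : ZMod p))] at h
  simp only [zero_mul, neg_zero, AddChar.map_zero_eq_one, cosChar_zero, Complex.ofReal_one,
    prod_const_one, one_mul, mul_one] at h
  have hcard : (Fintype.card (κ → ℤˣ) : ℝ) = 2 ^ (univ : Finset κ).card := by
    simp
  have key : ((prob {ξ : κ → ℤˣ | ∑ i, (((ξ i : ℤˣ) : ℤ) : ZMod p) * w i = x} -
      1 / (p : ℝ) : ℝ) : ℂ) =
      (∑ t ∈ univ.erase (0 : ZMod p), ZMod.stdAddChar (-(t * x)) *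
        ∏ i, (cosChar (t * w i) : ℂ)) / p := by
    unfold prob
    rw [hcard]
    have h2 : (2 : ℂ) ^ (univ : Finset κ).card ≠ 0 := pow_ne_zero _ two_ne_zero
    have h3 : ∑ t ∈ univ.erase (0 : ZMod p), ZMod.stdAddChar (-(t * x)) *
        (2 ^ (univ : Finset κ).card * ∏ i, (cosChar (t * w i) : ℂ)) =
        2 ^ (univ : Finset κ).card * ∑ t ∈ univ.erase (0 : ZMod p),
          ZMod.stdAddChar (-(t * x)) * ∏ i, (cosChar (t * w i) : ℂ) := by
      rw [mul_sum]
      exact sum_congr rfl fun t _ => by ring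
    rw [h3] at h
    push_cast
    rw [div_sub_div _ _ h2 hpc, div_eq_div_iff (mul_ne_zero h2 hpc) hpc]
    linear_combination (p : ℂ) * h
  rw [← Real.norm_eq_abs, ← Complex.norm_real, key, norm_div, Complex.norm_natCast]
  gcongr
  refine (norm_sum_le _ _).trans (sum_le_sum fun t _ => ?_)
  rw [norm_mul, norm_prod, ZMod.stdAddChar_apply, Circle.norm_coe, one_mul]
  simp [Complex.norm_real]

end

/-! ### Excess, near values and the greedy choice of coordinates -/

section

open scoped Pointwise

variable {p : ℕ} [Fact p.Prime] {ι : Type*}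

/-- The Fourier weight `∏_{i ∈ B} (3 + cos (4πt v_i / p)) / 4`: the characteristic function of a
lazy random walk with steps `± 2 v_i`. It dominates `∏_{i ∈ B} |cos (2πt v_i / p)|`, and unlike
the latter it is always a positive definite function of `t`. -/
noncomputable def weight (v : ι → ZMod p) (B : Finset ι) (t : ZMod p) : ℝ :=
  ∏ i ∈ B, (3 + cosChar (2 * (t * v i))) / 4

/-- The total Fourier weight of the nonzero frequencies. The law of the Rademacher sum
`∑_{i ∈ B} ξ_i v_i` differs from uniform by at most `excess v B / p` at each point. -/
noncomputable def excess (v : ι → ZMod p) (B : Finset ι) : ℝ :=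
  ∑ t ∈ univ.erase (0 : ZMod p), weight v B t

/-- Four times the amount by which the excess drops when a coordinate with value `u` is added
to `B`. -/
noncomputable def deficit (v : ι → ZMod p) (B : Finset ι) (u : ZMod p) : ℝ :=
  ∑ t ∈ univ.erase (0 : ZMod p), weight v B t * (1 - cosChar (2 * (t * u)))

/-- The values `u` whose addition to `B` lowers the excess by a proportion of at most `δ / 4`. -/
noncomputable def nearValues (v : ι → ZMod p) (B : Finset ι) (δ : ℝ) : Finset (ZMod p) :=
  univ.filter fun u => deficit v B u ≤ δ * excess v B

lemma weight_pos (v : ι → ZMod p) (B : Finset ι) (t : ZMod p) : 0 < weight v B t :=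
  prod_pos fun i _ => by linarith [neg_one_le_cosChar (2 * (t * v i))]

@[simp] lemma weight_zero (v : ι → ZMod p) (B : Finset ι) : weight v B 0 = 1 := by
  simp only [weight, zero_mul, mul_zero, cosChar_zero]
  norm_num

lemma excess_pos (v : ι → ZMod p) (B : Finset ι) : 0 < excess v B :=
  sum_pos (fun t _ => weight_pos v B t) ⟨1, by simp⟩

lemma excess_empty (v : ι → ZMod p) : excess v ∅ = p - 1 := by
  have := (Fact.out : p.Prime).one_le
  simp [excess, weight, card_erase_of_mem, ZMod.card, this]

lemma excess_anti (v : ι → ZMod p) {B B' : Finset ι} (h : B ⊆ B') :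
    excess v B' ≤ excess v B := by
  classical
  refine sum_le_sum fun t _ => ?_
  unfold weight
  rw [← prod_sdiff h]
  refine mul_le_of_le_one_left (weight_pos v B t).le (prod_le_one (fun i _ => ?_) fun i _ => ?_)
  · linarith [neg_one_le_cosChar (2 * (t * v i))]
  · linarith [cosChar_le_one (2 * (t * v i))]

lemma excess_insert [DecidableEq ι] (v : ι → ZMod p) {B : Finset ι} {i : ι} (hi : i ∉ B) :
    excess v (insert i B) = excess v B - deficit v B (v i) / 4 := by
  unfold excess deficit
  rw [sum_div, ← sum_sub_distrib]
  refine sum_congr rfl fun t _ => ?_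
  unfold weight
  rw [prod_insert hi]
  ring

lemma excess_congr {v w : ι → ZMod p} {B : Finset ι} (h : ∀ i ∈ B, v i = w i) :
    excess v B = excess w B :=
  sum_congr rfl fun t _ => prod_congr rfl fun i hi => by rw [h i hi]

lemma nearValues_congr {v w : ι → ZMod p} {B : Finset ι} (h : ∀ i ∈ B, v i = w i) (δ : ℝ) :
    nearValues v B δ = nearValues w B δ := by
  have hw : ∀ t, weight v B t = weight w B t := fun t => prod_congr rfl fun i hi => by rw [h i hi]
  unfold nearValues deficit
  simp_rw [excess_congr h, hw]

lemma abs_prob_sub_inv_le_excess (v : ι → ZMod p) (B : Finset ι) [DecidableEq B] (x : ZMod p) :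
    |prob {ξ : B → ℤˣ | ∑ i, (((ξ i : ℤˣ) : ℤ) : ZMod p) * v i = x} - 1 / (p : ℝ)| ≤
      excess v B / p := by
  refine (abs_prob_sub_inv_le (fun i : B => v i) x).trans ?_
  gcongr
  refine sum_le_sum fun t _ => ?_
  rw [weight, ← prod_coe_sort B]
  exact prod_le_prod (fun _ _ => abs_nonneg _) fun i _ => abs_cosChar_le _

lemma disc_le_excess_div [DecidableEq ι] (v : ι → ZMod p) (B : Finset ι) :
    disc (fun i : B => v i) ≤ excess v B / p :=
  ciSup_le fun x => abs_prob_sub_inv_le_excess v B x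

lemma prob_sum_eq_le (v : ι → ZMod p) (B : Finset ι) [DecidableEq B] (x : ZMod p) :
    prob {ξ : B → ℤˣ | ∑ i, (((ξ i : ℤˣ) : ℤ) : ZMod p) * v i = x} ≤ (1 + excess v B) / p := by
  have h := (abs_le.1 (abs_prob_sub_inv_le_excess v B x)).2
  rw [add_div]
  linarith

lemma zero_mem_nearValues (v : ι → ZMod p) (B : Finset ι) {δ : ℝ} (hδ : 0 ≤ δ) :
    0 ∈ nearValues v B δ := by
  rw [nearValues, mem_filter]
  refine ⟨mem_univ _, ?_⟩
  simp only [deficit, mul_zero, cosChar_zero, sub_self, sum_const_zero]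
  exact mul_nonneg hδ (excess_pos v B).le

lemma nearValues_add_subset (v : ι → ZMod p) (B : Finset ι) (δ : ℝ) :
    nearValues v B δ + nearValues v B δ ⊆ nearValues v B (4 * δ) := by
  intro u hu
  obtain ⟨x, hx, y, hy, rfl⟩ := mem_add.1 hu
  simp only [nearValues, mem_filter, mem_univ, true_and] at hx hy ⊢
  have : deficit v B (x + y) ≤ 2 * deficit v B x + 2 * deficit v B y := by
    unfold deficit
    rw [mul_sum, mul_sum, ← sum_add_distrib]
    refine sum_le_sum fun t _ => ?_
    have h := one_sub_cosChar_add_le (2 * (t * x)) (2 * (t * y))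
    rw [← mul_add, ← mul_add] at h
    nlinarith [weight_pos v B t]
  linarith

lemma two_ne_zero_zmod (hp : 2 < p) : (2 : ZMod p) ≠ 0 := by
  intro h
  have : ((2 : ℕ) : ZMod p) = 0 := by exact_mod_cast h
  rw [ZMod.natCast_eq_zero_iff] at this
  exact absurd (Nat.le_of_dvd two_pos this) (not_le.2 hp)

/-- The Fourier transform of the weight is nonnegative, being `p` times a probability. -/
lemma sum_weight_mul_cosChar_nonneg (v : ι → ZMod p) (B : Finset ι) (u : ZMod p) :
    0 ≤ ∑ t, weight v B t * cosChar (2 * (t * u)) := by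
  classical
  induction B using Finset.induction_on generalizing u with
  | empty =>
    have h := sum_cosChar_mul (p := p) (2 * u)
    simp only [weight, prod_empty, one_mul]
    simp_rw [mul_left_comm (2 : ZMod p), h]
    split_ifs <;> simp
  | insert i B hi ih =>
    have h : ∑ t, weight v (insert i B) t * cosChar (2 * (t * u)) =
        (3 / 4) * (∑ t, weight v B t * cosChar (2 * (t * u))) +
        (1 / 8) * (∑ t, weight v B t * cosChar (2 * (t * (u + v i)))) +
        (1 / 8) * (∑ t, weight v B t * cosChar (2 * (t * (u - v i)))) := by
      rw [mul_sum, mul_sum, mul_sum, ← sum_add_distrib, ← sum_add_distrib]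
      refine sum_congr rfl fun t _ => ?_
      have hc := cosChar_add_add_cosChar_sub (2 * (t * u)) (2 * (t * v i))
      rw [← mul_add, ← mul_sub, ← mul_add, ← mul_sub] at hc
      have hw : weight v (insert i B) t =
          (3 + cosChar (2 * (t * v i))) / 4 * weight v B t := prod_insert hi
      rw [hw]
      linear_combination (- weight v B t / 8) * hc
    rw [h]
    have h1 := ih u
    have h2 := ih (u + v i)
    have h3 := ih (u - v i)
    positivity

lemma sum_sum_weight_mul_cosChar (hp : 2 < p) (v : ι → ZMod p) (B : Finset ι) :
    ∑ u : ZMod p, ∑ t, weight v B t * cosChar (2 * (t * u)) = p := by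
  rw [sum_comm]
  have : ∀ t : ZMod p, ∑ u : ZMod p, weight v B t * cosChar (2 * (t * u)) =
      if t = 0 then (p : ℝ) else 0 := by
    intro t
    have h := sum_cosChar_mul (p := p) (2 * t)
    have h' : ∀ u : ZMod p, 2 * (t * u) = u * (2 * t) := fun u => by ring
    simp_rw [← mul_sum, h', h]
    by_cases ht : t = 0
    · simp [ht]
    · simp [ht, two_ne_zero_zmod hp]
  simp [this]

lemma sum_weight_mul_cosChar_eq (v : ι → ZMod p) (B : Finset ι) (u : ZMod p) :
    ∑ t, weight v B t * cosChar (2 * (t * u)) = 1 + excess v B - deficit v B u := by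
  rw [← add_sum_erase _ _ (mem_univ (0 : ZMod p)), excess, deficit, add_sub_assoc,
    ← sum_sub_distrib]
  congr 1
  · simp
  · exact sum_congr rfl fun t _ => by ring

/-- Markov's inequality for the lazy walk: its law has mass at least `(1 + excess / 2) / p` at
every point of `nearValues v B (1 / 2)`. -/
lemma card_nearValues_half_mul_le (hp : 2 < p) (v : ι → ZMod p) (B : Finset ι) :
    ((nearValues v B (1 / 2)).card : ℝ) * (1 + excess v B / 2) ≤ p := by
  rw [← sum_sum_weight_mul_cosChar hp v B, ← nsmul_eq_mul, ← sum_const]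
  refine le_trans (sum_le_sum fun u hu => ?_)
    (sum_le_univ_sum_of_nonneg fun u => sum_weight_mul_cosChar_nonneg v B u)
  rw [sum_weight_mul_cosChar_eq]
  have := (mem_filter.1 hu).2
  linarith

/-- Cauchy–Davenport, iterated: near values with a small parameter are rare, because their
sumsets still consist of near values. -/
lemma two_pow_mul_card_nearValues_sub_one_le (hp : 2 < p) (v : ι → ZMod p) (B : Finset ι)
    {δ : ℝ} (hδ : 0 ≤ δ) (k : ℕ) (hk : 4 ^ k * δ ≤ 1 / 2) :
    2 ^ k * ((nearValues v B δ).card - 1 : ℕ) ≤ (nearValues v B (4 ^ k * δ)).card - 1 := by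
  induction k with
  | zero => simp
  | succ k ih =>
    have h4 : (4 : ℝ) ^ (k + 1) * δ = 4 * (4 ^ k * δ) := by ring
    have hk0 : 0 ≤ 4 ^ k * δ := by positivity
    rw [h4] at hk ⊢
    have ih := ih (by linarith)
    set A := nearValues v B (4 ^ k * δ)
    have hA : A.Nonempty := ⟨0, zero_mem_nearValues v B hk0⟩
    have hcd := ZMod.cauchy_davenport (Fact.out : p.Prime) hA hA
    have hle := card_le_card (nearValues_add_subset v B (4 ^ k * δ))
    have hsub : nearValues v B (4 * (4 ^ k * δ)) ⊆ nearValues v B (1 / 2) := by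
      intro u hu
      simp only [nearValues, mem_filter, mem_univ, true_and] at hu ⊢
      nlinarith [excess_pos v B]
    have hlt : (nearValues v B (4 * (4 ^ k * δ))).card < p := by
      refine lt_of_le_of_lt (card_le_card hsub) ?_
      have h := card_nearValues_half_mul_le hp v B
      have hpos := excess_pos v B
      have hp' : (0 : ℝ) < p := by exact_mod_cast (Fact.out : p.Prime).pos
      by_contra hcon
      have hcon' : (p : ℝ) ≤ (nearValues v B (1 / 2)).card := by exact_mod_cast not_lt.1 hcon
      nlinarith
    have := le_trans hcd hle
    rw [min_le_iff] at this
    rw [pow_succ']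
    have : A.card + A.card - 1 ≤ (nearValues v B (4 * (4 ^ k * δ))).card := by omega
    rw [mul_assoc]
    omega

/-- Few values leave the excess almost unchanged: the set of such values has at most
`1 + 2 ^ (1 - k) / f` elements, where `f = (1 + excess v B) / p` bounds the atoms of the
Rademacher sum over `B`. -/
lemma card_nearValues_le (hp : 2 < p) (v : ι → ZMod p) (B : Finset ι) (k : ℕ) :
    ((nearValues v B (1 / (2 * 4 ^ k))).card : ℝ) ≤
      1 + 2 / 2 ^ k * (p / (1 + excess v B)) := by
  have hδ : (0 : ℝ) ≤ 1 / (2 * 4 ^ k) := by positivity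
  have h4 : (4 : ℝ) ^ k * (1 / (2 * 4 ^ k)) = 1 / 2 := by field_simp
  have h := two_pow_mul_card_nearValues_sub_one_le hp v B hδ k h4.le
  rw [h4] at h
  have h1 := card_nearValues_half_mul_le hp v B
  have hpos := excess_pos v B
  have hA : 1 ≤ (nearValues v B (1 / (2 * 4 ^ k))).card :=
    card_pos.2 ⟨0, zero_mem_nearValues v B hδ⟩
  have h2 : (2 : ℝ) ^ k * ((nearValues v B (1 / (2 * 4 ^ k))).card - 1) ≤
      (nearValues v B (1 / 2)).card := by
    have : 2 ^ k * ((nearValues v B (1 / (2 * 4 ^ k))).card - 1 : ℕ) ≤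
      (nearValues v B (1 / 2)).card := h.trans (Nat.sub_le _ _)
    have h3 : (((2 ^ k * ((nearValues v B (1 / (2 * 4 ^ k))).card - 1 : ℕ) : ℕ)) : ℝ) ≤
      (nearValues v B (1 / 2)).card := by exact_mod_cast this
    push_cast [hA] at h3
    exact h3
  have h5 : ((nearValues v B (1 / 2)).card : ℝ) ≤ 2 * (p / (1 + excess v B)) := by
    rw [← mul_div_assoc, le_div_iff₀ (by linarith)]
    nlinarith [(Nat.cast_nonneg (nearValues v B (1 / 2)).card : (0 : ℝ) ≤ _)]
  have h6 : ((nearValues v B (1 / (2 * 4 ^ k))).card : ℝ) - 1 ≤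
      2 * (p / (1 + excess v B)) / 2 ^ k := by
    rw [le_div_iff₀ (by positivity)]
    linarith
  calc _ ≤ 1 + 2 * (p / (1 + excess v B)) / 2 ^ k := by linarith
    _ = _ := by ring

/-- A greedy choice of coordinates from `D`. Each one lowers the excess by the factor
`1 - δ / 4`, until either `m` of them have been chosen or every other coordinate in `D` has a
near value. -/
lemma exists_greedy_subset [DecidableEq ι] (v : ι → ZMod p) (D : Finset ι) (m : ℕ) {δ : ℝ}
    (hδ4 : δ ≤ 4) :
    ∃ B ⊆ D, B.card ≤ m ∧ excess v B ≤ (1 - δ / 4) ^ B.card * p ∧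
      (B.card = m ∨ ∀ i ∈ D \ B, v i ∈ nearValues v B δ) := by
  have hne : (D.powerset.filter fun B => B.card ≤ m ∧
      excess v B ≤ (1 - δ / 4) ^ B.card * p).Nonempty :=
    ⟨∅, by simp [excess_empty]⟩
  obtain ⟨B, hB, hmax⟩ := exists_max_image _ Finset.card hne
  rw [mem_filter, mem_powerset] at hB
  refine ⟨B, hB.1, hB.2.1, hB.2.2, or_iff_not_imp_left.2 fun hBm i hi => ?_⟩
  rw [mem_sdiff] at hi
  by_contra hcon
  have hins := excess_insert v hi.2
  have hci := card_insert_of_notMem hi.2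
  have := hmax (insert i B) (by
    rw [mem_filter, mem_powerset, hci]
    refine ⟨insert_subset hi.1 hB.1, by have := hB.2.1; omega, ?_⟩
    simp only [nearValues, mem_filter, mem_univ, true_and, not_le] at hcon
    rw [pow_succ', mul_assoc]
    have h1 : (1 - δ / 4) * excess v B ≤ (1 - δ / 4) * ((1 - δ / 4) ^ B.card * p) :=
      mul_le_mul_of_nonneg_left hB.2.2 (by linarith)
    linarith)
  omega

end

/-! ### Rows orthogonal to a fixed vector -/

section prob

variable {Ω : Type*} [Fintype Ω]

lemma prob_mono {E F : Set Ω} (h : E ⊆ F) : prob E ≤ prob F := by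
  unfold prob
  gcongr
  exact Set.toFinite F

lemma prob_nonneg (E : Set Ω) : 0 ≤ prob E := by
  unfold prob
  positivity

lemma prob_le_one (E : Set Ω) : prob E ≤ 1 := by
  refine div_le_one_of_le₀ ?_ (Nat.cast_nonneg _)
  rw [← Nat.card_eq_fintype_card]
  exact_mod_cast Set.ncard_le_card E

lemma prob_compl [Nonempty Ω] (E : Set Ω) : prob Eᶜ = 1 - prob E := by
  have h := Set.ncard_add_ncard_compl E
  rw [Nat.card_eq_fintype_card] at h
  have hc : (0 : ℝ) < Fintype.card Ω := by exact_mod_cast Fintype.card_pos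
  have h' : (E.ncard : ℝ) + (Eᶜ.ncard : ℝ) = Fintype.card Ω := by exact_mod_cast h
  unfold prob
  rw [eq_sub_iff_add_eq, ← add_div, add_comm, h', div_self hc.ne']

lemma prob_biUnion_le {κ : Type*} (s : Finset κ) (E : κ → Set Ω) :
    prob (⋃ k ∈ s, E k) ≤ ∑ k ∈ s, prob (E k) := by
  unfold prob
  rw [← sum_div]
  gcongr
  exact_mod_cast Finset.set_ncard_biUnion_le s E

open Classical in
lemma prob_eq_sum (E : Set Ω) :
    prob E = (∑ ω, if ω ∈ E then (1 : ℝ) else 0) / Fintype.card Ω := by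
  unfold prob
  rw [sum_boole, Set.ncard_eq_toFinset_card']
  congr 3
  ext ω
  simp

end prob

section resampling

variable {p : ℕ} {J κ : Type*} [Fintype J] [DecidableEq J] [Fintype κ] [DecidableEq κ]

/-- Resampling the signs with indices `e j`: an event `E` and a target `Z` that do not depend on
these signs leave the conditional law of the Rademacher sum `∑_j ω (e j) w_j` unchanged. -/
lemma prob_inter_sum_eq_le {e : κ → J} (he : e.Injective) (E : Set (J → ℤˣ))
    (Z : (J → ℤˣ) → ZMod p) (w : κ → ZMod p)
    (hE : ∀ (ω : J → ℤˣ) (ξ : κ → ℤˣ), ω * Function.extend e ξ (1 : J → ℤˣ) ∈ E ↔ ω ∈ E)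
    (hZ : ∀ (ω : J → ℤˣ) (ξ : κ → ℤˣ), Z (ω * Function.extend e ξ (1 : J → ℤˣ)) = Z ω) {g : ℝ}
    (hg : ∀ x, prob {ξ : κ → ℤˣ | ∑ j, (((ξ j : ℤˣ) : ℤ) : ZMod p) * w j = x} ≤ g) :
    prob (E ∩ {ω | ∑ j, (((ω (e j) : ℤˣ) : ℤ) : ZMod p) * w j = Z ω}) ≤ g * prob E := by
  classical
  set F := E ∩ {ω | ∑ j, (((ω (e j) : ℤˣ) : ℤ) : ZMod p) * w j = Z ω} with hF
  clear_value F
  have hN : (0 : ℝ) < Fintype.card (κ → ℤˣ) := by exact_mod_cast Fintype.card_pos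
  have hflip : ∀ ξ : κ → ℤˣ, (∑ ω, if ω ∈ F then (1 : ℝ) else 0) =
      ∑ ω, if ω * Function.extend e ξ 1 ∈ F then (1 : ℝ) else 0 := fun ξ =>
    (Fintype.sum_equiv (Equiv.mulRight (Function.extend e ξ 1)) _ _ fun ω => rfl).symm
  have hsum : ∀ ω, (∑ ξ : κ → ℤˣ, if ω * Function.extend e ξ 1 ∈ F then (1 : ℝ) else 0) ≤
      (if ω ∈ E then (1 : ℝ) else 0) * (g * Fintype.card (κ → ℤˣ)) := by
    intro ω
    by_cases hω : ω ∈ E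
    · have h := hg (Z ω)
      rw [prob_eq_sum, div_le_iff₀ hN] at h
      rw [if_pos hω, one_mul]
      refine le_trans (le_of_eq ?_) h
      refine Fintype.sum_equiv (Equiv.mulLeft (ω ∘ e)) _ _ fun ξ => ?_
      have hiff : ω * Function.extend e ξ 1 ∈ F ↔ Equiv.mulLeft (ω ∘ e) ξ ∈
          {ξ : κ → ℤˣ | ∑ j, (((ξ j : ℤˣ) : ℤ) : ZMod p) * w j = Z ω} := by
        rw [hF, Set.mem_inter_iff, hE, Set.mem_ofPred_eq, hZ]
        simp [hω, he.extend_apply]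
      by_cases h : ω * Function.extend e ξ 1 ∈ F
      · rw [if_pos h, if_pos (hiff.1 h)]
      · rw [if_neg h, if_neg (mt hiff.2 h)]
    · rw [if_neg hω, zero_mul]
      refine le_of_eq (sum_eq_zero fun ξ _ => if_neg fun h => hω ?_)
      exact (hE ω ξ).1 (hF.subset h).1
  have hmain : Fintype.card (κ → ℤˣ) * (∑ ω, if ω ∈ F then (1 : ℝ) else 0) ≤
      (∑ ω, if ω ∈ E then (1 : ℝ) else 0) * (g * Fintype.card (κ → ℤˣ)) := by
    calc Fintype.card (κ → ℤˣ) * (∑ ω, if ω ∈ F then (1 : ℝ) else 0)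
        = ∑ ξ : κ → ℤˣ, ∑ ω, if ω * Function.extend e ξ 1 ∈ F then (1 : ℝ) else 0 := by
          rw [← sum_congr rfl fun ξ _ => hflip ξ, sum_const, nsmul_eq_mul, card_univ]
      _ = ∑ ω, ∑ ξ : κ → ℤˣ, if ω * Function.extend e ξ 1 ∈ F then (1 : ℝ) else 0 := sum_comm
      _ ≤ _ := by
          rw [sum_mul]
          exact sum_le_sum fun ω _ => hsum ω
  rw [prob_eq_sum F, prob_eq_sum E, ← mul_div_assoc]
  refine div_le_div_of_nonneg_right ?_ (Nat.cast_nonneg _)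
  refine le_of_mul_le_mul_left ?_ hN
  linarith

end resampling

section rows

variable {n p : ℕ}

lemma shiftedMatrix_apply (a : ZMod p) (ω : Sym2 (Fin n) → ℤˣ) (i j : Fin n) :
    shiftedMatrix p a ω i j =
      (((ω s(i, j) : ℤˣ) : ℤ) : ZMod p) - a * (1 : Matrix (Fin n) (Fin n) (ZMod p)) i j := by
  simp [shiftedMatrix, radMatrix]

lemma shiftedMatrix_dotProduct (a : ZMod p) (ω : Sym2 (Fin n) → ℤˣ) (v : Fin n → ZMod p)
    (i : Fin n) :
    shiftedMatrix p a ω i ⬝ᵥ v = (∑ j, (((ω s(i, j) : ℤˣ) : ℤ) : ZMod p) * v j) - a * v i := by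
  simp [dotProduct, shiftedMatrix_apply, sub_mul, Matrix.one_apply]

/-- The block of entries in rows `R` and columns `B` consists of independent signs if `R` and
`B` are disjoint. -/
lemma prob_forall_dotProduct_eq_zero_le (a : ZMod p) (v : Fin n → ZMod p) (B R : Finset (Fin n))
    (hRB : Disjoint R B) {g : ℝ} (hg0 : 0 ≤ g)
    (hg : ∀ x, prob {ξ : B → ℤˣ | ∑ j, (((ξ j : ℤˣ) : ℤ) : ZMod p) * v j = x} ≤ g) :
    prob {ω : Sym2 (Fin n) → ℤˣ | ∀ i ∈ R, shiftedMatrix p a ω i ⬝ᵥ v = 0} ≤ g ^ R.card := by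
  classical
  induction R using Finset.induction_on with
  | empty => simpa using prob_le_one _
  | insert i R hi ih =>
    rw [disjoint_insert_left] at hRB
    have he : Function.Injective (fun j : B => s(i, (j : Fin n))) := by
      intro j k hjk
      exact Subtype.ext (Sym2.congr_right.1 hjk)
    -- Changing the entries `(i, j)` with `j ∈ B` affects no other row outside `B`.
    have hother : ∀ (ω : Sym2 (Fin n) → ℤˣ) (ξ : B → ℤˣ) (k l : Fin n),
        (∀ j ∈ B, s(i, j) ≠ s(k, l)) →
        (ω * Function.extend (fun j : B => s(i, (j : Fin n))) ξ 1) s(k, l) = ω s(k, l) := by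
      intro ω ξ k l h
      rw [Pi.mul_apply, Function.extend_apply' _ _ _ (by rintro ⟨j, hj⟩; exact h j j.2 hj),
        Pi.one_apply, mul_one]
    have hrow : ∀ (ω : Sym2 (Fin n) → ℤˣ) (ξ : B → ℤˣ), ∀ k ∈ R,
        shiftedMatrix p a (ω * Function.extend (fun j : B => s(i, (j : Fin n))) ξ 1) k ⬝ᵥ v =
          shiftedMatrix p a ω k ⬝ᵥ v := by
      intro ω ξ k hk
      rw [shiftedMatrix_dotProduct, shiftedMatrix_dotProduct]
      congr 1
      refine sum_congr rfl fun l _ => ?_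
      rw [hother ω ξ k l]
      intro j hj h
      rw [Sym2.eq_iff] at h
      rcases h with ⟨rfl, -⟩ | ⟨-, rfl⟩
      · exact hi hk
      · exact disjoint_left.1 hRB.2 hk hj
    have hstep := prob_inter_sum_eq_le he
      {ω : Sym2 (Fin n) → ℤˣ | ∀ i ∈ R, shiftedMatrix p a ω i ⬝ᵥ v = 0}
      (fun ω => a * v i - ∑ j ∈ univ \ B, (((ω s(i, j) : ℤˣ) : ℤ) : ZMod p) * v j)
      (fun j : B => v j)
      (fun ω ξ => forall₂_congr fun k hk => by rw [hrow ω ξ k hk])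
      (fun ω ξ => by
        congr 1
        refine sum_congr rfl fun l hl => ?_
        rw [hother ω ξ i l]
        intro j hj h
        rw [Sym2.congr_right] at h
        exact (mem_sdiff.1 hl).2 (h ▸ hj)) hg
    rw [card_insert_of_notMem hi, pow_succ']
    refine le_trans (prob_mono ?_) (hstep.trans (mul_le_mul_of_nonneg_left (ih hRB.2) hg0))
    intro ω hω
    refine ⟨fun k hk => hω k (mem_insert_of_mem hk), ?_⟩
    have h := hω i (mem_insert_self i R)
    rw [shiftedMatrix_dotProduct, ← sum_sdiff (subset_univ B)] at h
    rw [Set.mem_ofPred_eq, sum_coe_sort B fun j => (((ω s(i, j) : ℤˣ) : ℤ) : ZMod p) * v j]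
    linear_combination h

/-- The number of subsets with at most `q` elements, bounded by an exponential moment. -/
lemma card_filter_card_le {ι : Type*} [Fintype ι] [DecidableEq ι] (q : ℕ) {y : ℝ} (hy : 0 < y)
    (hy1 : y ≤ 1) :
    ((univ.filter fun B : Finset ι => B.card ≤ q).card : ℝ) ≤
      (1 + y) ^ Fintype.card ι * y⁻¹ ^ q := by
  have h : ∑ B : Finset ι, y ^ B.card = (1 + y) ^ Fintype.card ι := by
    have := Finset.sum_pow_mul_eq_add_pow y 1 (univ : Finset ι)
    simpa [add_comm] using this
  rw [← h, sum_mul, card_eq_sum_ones, Nat.cast_sum, sum_filter]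
  push_cast
  refine sum_le_sum fun B _ => ?_
  split_ifs with hB
  · rw [inv_pow, ← div_eq_mul_inv, one_le_div (by positivity)]
    exact pow_le_pow_of_le_one hy.le hy1 hB
  · positivity

/-- All but `q` of the rows are orthogonal to `v` with probability at most `g ^ (n - q - |B|)`,
up to the number of choices of these rows, if every atom of the Rademacher sum over `B` is at
most `g`. -/
lemma prob_orthRows_ge_le (a : ZMod p) (v : Fin n → ZMod p) (B : Finset (Fin n)) (q : ℕ) {g : ℝ}
    (hg0 : 0 ≤ g) (hg1 : g ≤ 1)
    (hg : ∀ x, prob {ξ : B → ℤˣ | ∑ j, (((ξ j : ℤˣ) : ℤ) : ZMod p) * v j = x} ≤ g) :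
    prob {ω : Sym2 (Fin n) → ℤˣ | n ≤ orthRows (shiftedMatrix p a ω) v + q} ≤
      (univ.filter fun R : Finset (Fin n) => R.card ≤ q).card * g ^ (n - q - B.card) := by
  classical
  have hsub : {ω : Sym2 (Fin n) → ℤˣ | n ≤ orthRows (shiftedMatrix p a ω) v + q} ⊆
      ⋃ R ∈ univ.filter fun R : Finset (Fin n) => R.card ≤ q,
        {ω | ∀ i ∈ Rᶜ \ B, shiftedMatrix p a ω i ⬝ᵥ v = 0} := by
    intro ω hω
    simp only [Set.mem_iUnion, exists_prop]
    refine ⟨univ.filter fun i => ¬ shiftedMatrix p a ω i ⬝ᵥ v = 0, ?_, ?_⟩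
    · rw [mem_filter]
      refine ⟨mem_univ _, ?_⟩
      have hω' : n ≤ orthRows (shiftedMatrix p a ω) v + q := hω
      rw [orthRows, Set.ncard_eq_toFinset_card'] at hω'
      have h := card_filter_add_card_filter_not (s := (univ : Finset (Fin n)))
        (fun i => shiftedMatrix p a ω i ⬝ᵥ v = 0)
      have h2 : (Set.toFinset {i : Fin n | shiftedMatrix p a ω i ⬝ᵥ v = 0}) =
        univ.filter fun i => shiftedMatrix p a ω i ⬝ᵥ v = 0 := by ext; simp
      rw [h2] at hω'
      rw [card_univ, Fintype.card_fin] at h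
      omega
    · intro i hi
      simpa using (mem_sdiff.1 hi).1
  refine (prob_mono hsub).trans ((prob_biUnion_le _ _).trans ?_)
  rw [← nsmul_eq_mul]
  refine sum_le_card_nsmul _ _ _ fun R hR => ?_
  refine (prob_forall_dotProduct_eq_zero_le a v B _ sdiff_disjoint hg0 hg).trans ?_
  refine pow_le_pow_of_le_one hg0 hg1 ?_
  have h1 := le_card_sdiff B Rᶜ
  rw [card_compl, Fintype.card_fin] at h1
  have := (mem_filter.1 hR).2
  omega

end rows

/-! ### Counting vectors without many uniform blocks -/

section

variable {n p : ℕ}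

/-- If `v` does not have many uniform blocks, then a maximal disjoint family of uniform blocks
leaves a large set of coordinates in which no block is uniform. -/
lemma exists_large_set_of_not_manyUniformBlocks {C : ℝ} {m : ℕ} {v : Fin n → ZMod p} (hm : 0 < m)
    (hn : 20 ≤ n) (h : ¬ ManyUniformBlocks C m v) :
    ∃ U : Finset (Fin n), n ≤ 5 * U.card ∧
      ∀ S ⊆ U, S.card = m → C / (p : ℝ) ^ 2 < disc (fun i : S => v i) := by
  classical
  unfold ManyUniformBlocks at h
  push Not at h
  obtain ⟨T, hT, h⟩ := h
  let 𝓕 : Finset (Finset (Finset (Fin n))) := univ.filter fun F =>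
    (∀ S ∈ F, ∀ S' ∈ F, S ≠ S' → Disjoint S S') ∧
      ∀ S ∈ F, S.card = m ∧ Disjoint S T ∧ disc (fun i : S => v i) ≤ C / (p : ℝ) ^ 2
  have hne : 𝓕.Nonempty := ⟨∅, by simp [𝓕]⟩
  obtain ⟨F, hF, hmax⟩ := exists_max_image 𝓕 Finset.card hne
  obtain ⟨hdis, hgood⟩ := (mem_filter.1 hF).2
  have hcard : (F.card : ℝ) < n / (2 * m) := by
    by_contra hcon
    obtain ⟨S, hS, hS'⟩ := h F (not_lt.1 hcon) hdis
    exact absurd (hgood S hS).2.2 (not_le.2 (hS' (hgood S hS).1 (hgood S hS).2.1))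
  have hmr : (0 : ℝ) < m := by exact_mod_cast hm
  rw [lt_div_iff₀ (by positivity)] at hcard
  have hcard' : F.card * (2 * m) < n := by exact_mod_cast hcard
  refine ⟨univ \ (T ∪ F.biUnion id), ?_, ?_⟩
  · have h1 : (F.biUnion id).card ≤ F.card * m :=
      card_biUnion_le_card_mul _ _ _ fun S hS => ((hgood S hS).1).le
    have h2 : T.card ≤ n / 4 + 1 := by
      refine hT.trans (Nat.ceil_le.2 ?_)
      have : n ≤ 4 * (n / 4 + 1) := by omega
      rw [div_le_iff₀ (by norm_num)]
      have h' : (n : ℝ) ≤ ((4 * (n / 4 + 1) : ℕ) : ℝ) := by exact_mod_cast this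
      push_cast at h' ⊢
      linarith
    have h3 := card_union_le T (F.biUnion id)
    have h4 := le_card_sdiff (T ∪ F.biUnion id) (univ : Finset (Fin n))
    rw [card_univ, Fintype.card_fin] at h4
    have h5 : F.card * (2 * m) = 2 * (F.card * m) := by ring
    omega
  · intro S hSU hSm
    by_contra hcon
    have hSd : ∀ i ∈ S, i ∉ T ∧ ∀ S' ∈ F, i ∉ S' := by
      intro i hi
      have := hSU hi
      simp only [mem_sdiff, mem_univ, true_and, mem_union, mem_biUnion, id, not_or, not_exists,
        not_and] at this
      exact this
    have hSdis : ∀ S' ∈ F, Disjoint S S' := fun S' hS' =>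
      disjoint_left.2 fun i hi => (hSd i hi).2 S' hS'
    have hSF : S ∉ F := by
      intro hmem
      obtain ⟨i, hi⟩ := card_pos.1 (hSm ▸ hm)
      exact (hSd i hi).2 S hmem hi
    have := hmax (insert S F) (by
      refine mem_filter.2 ⟨mem_univ _, ?_, ?_⟩
      · intro S₁ h₁ S₂ h₂ hne
        rcases mem_insert.1 h₁ with rfl | h₁' <;> rcases mem_insert.1 h₂ with rfl | h₂'
        · exact absurd rfl hne
        · exact hSdis _ h₂'
        · exact (hSdis _ h₁').symm
        · exact hdis _ h₁' _ h₂' hne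
      · intro S₁ h₁
        rcases mem_insert.1 h₁ with rfl | h₁
        · exact ⟨hSm, disjoint_left.2 fun i hi => (hSd i hi).1, not_lt.1 hcon⟩
        · exact hgood _ h₁)
    rw [card_insert_of_notMem hSF] at this
    omega

/-- Union bound for vectors determined up to few choices by a few of their coordinates: if the
coordinates of `v` outside `B` lie in sets `A i` that depend only on the restriction of `v` to
`B`, then the weights `P v ≤ X / ∏ |A i|` sum to at most `p ^ |B| * X`. -/
lemma sum_le_pow_mul_of_mem [NeZero p] (P : (Fin n → ZMod p) → ℝ) (B : Finset (Fin n))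
    (V : Finset (Fin n → ZMod p)) (A : (Fin n → ZMod p) → Fin n → Finset (ZMod p)) {X : ℝ}
    (hX0 : 0 ≤ X) (hA : ∀ v ∈ V, ∀ i ∉ B, v i ∈ A (B.piecewise v 0) i)
    (hX : ∀ v ∈ V, P v * ∏ i ∈ univ \ B, ((A (B.piecewise v 0) i).card : ℝ) ≤ X) :
    ∑ v ∈ V, P v ≤ p ^ B.card * X := by
  classical
  let W : Finset (Fin n → ZMod p) := Fintype.piFinset fun i => if i ∈ B then univ else {0}
  have hW : W.card = p ^ B.card := by
    rw [Fintype.card_piFinset, ← prod_sdiff (subset_univ B), prod_eq_one, one_mul]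
    · rw [prod_congr rfl fun i hi => by rw [if_pos hi, card_univ, ZMod.card], prod_const]
    · intro i hi
      rw [if_neg (mem_sdiff.1 hi).2, card_singleton]
  have hmaps : ∀ v ∈ V, B.piecewise v 0 ∈ W := by
    intro v _
    refine Fintype.mem_piFinset.2 fun i => ?_
    by_cases hi : i ∈ B <;> simp [hi]
  rw [← sum_fiberwise_of_maps_to hmaps]
  have hcast : (p : ℝ) ^ B.card * X = W.card • X := by rw [hW, nsmul_eq_mul]; push_cast; rfl
  rw [hcast]
  refine sum_le_card_nsmul _ _ _ fun w _ => ?_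
  set G := V.filter fun v => B.piecewise v 0 = w with hG
  rcases G.eq_empty_or_nonempty with hempty | ⟨v₀, hv₀⟩
  · rw [hempty, sum_empty]; exact hX0
  have hsub : G ⊆ Fintype.piFinset fun i => if i ∈ B then {w i} else A w i := by
    intro v hv
    obtain ⟨hvV, rfl⟩ := mem_filter.1 hv
    refine Fintype.mem_piFinset.2 fun i => ?_
    by_cases hi : i ∈ B
    · simp [hi]
    · rw [if_neg hi]; exact hA v hvV i hi
  have hcard : (G.card : ℝ) ≤ ∏ i ∈ univ \ B, ((A w i).card : ℝ) := by
    have h := card_le_card hsub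
    rw [Fintype.card_piFinset, ← prod_sdiff (subset_univ B),
      prod_eq_one (s := B) fun i hi => by rw [if_pos hi, card_singleton], mul_one,
      prod_congr rfl fun i hi => by rw [if_neg (mem_sdiff.1 hi).2]] at h
    exact_mod_cast h
  set a := ∏ i ∈ univ \ B, ((A w i).card : ℝ) with ha_def
  have hGpos : (1 : ℝ) ≤ G.card := by exact_mod_cast card_pos.2 ⟨v₀, hv₀⟩
  have ha : 0 < a := by linarith
  have hP : ∀ v ∈ G, P v ≤ X / a := by
    intro v hv
    obtain ⟨hvV, hvw⟩ := mem_filter.1 hv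
    have := hX v hvV
    rw [hvw, ← ha_def] at this
    rwa [le_div_iff₀ ha]
  clear_value a
  calc ∑ v ∈ G, P v ≤ G.card • (X / a) := sum_le_card_nsmul _ _ _ hP
    _ = G.card * (X / a) := nsmul_eq_mul _ _
    _ ≤ a * (X / a) := by gcongr
    _ = X := mul_div_cancel₀ _ ha.ne'

/-- The union bound of `sum_le_pow_mul_of_mem`, over several choices `b ∈ ℬ` of the determining
set `β b` and of the sets of values `A b`. -/
lemma sum_le_card_mul_of_cover [NeZero p] {κ : Type*} (ℬ : Finset κ) (β : κ → Finset (Fin n))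
    {m : ℕ} (hβ : ∀ b ∈ ℬ, (β b).card ≤ m) (P : (Fin n → ZMod p) → ℝ) (hP : ∀ v, 0 ≤ P v)
    (V : Finset (Fin n → ZMod p)) (Q : κ → (Fin n → ZMod p) → Prop)
    (A : κ → (Fin n → ZMod p) → Fin n → Finset (ZMod p)) {X : ℝ} (hX0 : 0 ≤ X)
    (hQ : ∀ v ∈ V, ∃ b ∈ ℬ, Q b v)
    (hA : ∀ b ∈ ℬ, ∀ v ∈ V, Q b v → ∀ i ∉ β b, v i ∈ A b ((β b).piecewise v 0) i)
    (hX : ∀ b ∈ ℬ, ∀ v ∈ V, Q b v →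
      P v * ∏ i ∈ univ \ β b, ((A b ((β b).piecewise v 0) i).card : ℝ) ≤ X) :
    ∑ v ∈ V, P v ≤ ℬ.card * (p ^ m * X) := by
  classical
  have h1 : ∑ v ∈ V, P v ≤ ∑ b ∈ ℬ, ∑ v ∈ V.filter (Q b), P v := by
    simp_rw [sum_filter]
    rw [sum_comm]
    refine sum_le_sum fun v hv => ?_
    obtain ⟨b, hb, hbv⟩ := hQ v hv
    have := single_le_sum (f := fun b => if Q b v then P v else 0)
      (fun b _ => by split_ifs <;> simp [hP v]) hb
    simpa [hbv] using this
  refine h1.trans ?_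
  rw [← nsmul_eq_mul]
  refine sum_le_card_nsmul _ _ _ fun b hb => ?_
  refine (sum_le_pow_mul_of_mem P (β b) _ (A b) hX0
    (fun v hv => hA b hb v (mem_filter.1 hv).1 (mem_filter.1 hv).2)
    (fun v hv => hX b hb v (mem_filter.1 hv).1 (mem_filter.1 hv).2)).trans ?_
  have hp1 : (1 : ℝ) ≤ p := by exact_mod_cast Nat.one_le_iff_ne_zero.2 (NeZero.ne p)
  gcongr
  exact hβ b hb

section cases

variable [Fact p.Prime]

lemma prob_single_sign_le_half (hp : 2 < p) (v : Fin n → ZMod p) {j : Fin n} (hj : v j ≠ 0)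
    (x : ZMod p) :
    prob {ξ : ({j} : Finset (Fin n)) → ℤˣ | ∑ i, (((ξ i : ℤˣ) : ℤ) : ZMod p) * v i = x} ≤
      1 / 2 := by
  have hcard : Fintype.card (({j} : Finset (Fin n)) → ℤˣ) = 2 := by simp
  unfold prob
  rw [hcard]
  push_cast
  gcongr
  have : {ξ : ({j} : Finset (Fin n)) → ℤˣ |
      ∑ i, (((ξ i : ℤˣ) : ℤ) : ZMod p) * v i = x}.ncard ≤ 1 := by
    rw [Set.ncard_le_one]
    have hsum : ∀ ξ : ({j} : Finset (Fin n)) → ℤˣ, ∑ i, (((ξ i : ℤˣ) : ℤ) : ZMod p) * v i =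
        (((ξ ⟨j, mem_singleton_self j⟩ : ℤˣ) : ℤ) : ZMod p) * v j := fun ξ =>
      Fintype.sum_subsingleton _ (⟨j, mem_singleton_self j⟩ : ({j} : Finset (Fin n)))
    intro ξ hξ ξ' hξ'
    rw [Set.mem_ofPred_eq, hsum] at hξ hξ'
    have h := mul_right_cancel₀ hj (hξ.trans hξ'.symm)
    funext i
    obtain ⟨i, hi⟩ := i
    obtain rfl := mem_singleton.1 hi
    have h2 := two_ne_zero_zmod hp
    rcases Int.units_eq_one_or (ξ ⟨i, hi⟩) with h1 | h1 <;>
      rcases Int.units_eq_one_or (ξ' ⟨i, hi⟩) with h1' | h1' <;> rw [h1, h1'] at h ⊢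
    · exfalso; apply h2; push_cast at h; linear_combination h
    · exfalso; apply h2; push_cast at h; linear_combination -h
  exact_mod_cast this

/-- The event that all but `q` rows of the matrix are orthogonal to `v`. -/
def nearKernelEvent (a : ZMod p) (q : ℕ) (v : Fin n → ZMod p) : Set (Sym2 (Fin n) → ℤˣ) :=
  {ω | n ≤ orthRows (shiftedMatrix p a ω) v + q}

variable (n) in
/-- The number of subsets of `Fin n` with at most `q` elements. -/
def numSmallSubsets (q : ℕ) : ℕ := (univ.filter fun R : Finset (Fin n) => R.card ≤ q).card

variable (n) in
lemma numSmallSubsets_le_two_pow (q : ℕ) : (numSmallSubsets n q : ℝ) ≤ 2 ^ n := by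
  have : numSmallSubsets n q ≤ 2 ^ n := by
    refine (card_le_univ _).trans ?_
    simp
  exact_mod_cast this

lemma prob_nearKernelEvent_le (a : ZMod p) (q m : ℕ) (v : Fin n → ZMod p) (B : Finset (Fin n))
    (hB : B.card ≤ m) :
    prob (nearKernelEvent a q v) ≤
      numSmallSubsets n q * ((1 + excess v B) / p) ^ (n - q - m) := by
  have hp : (0 : ℝ) < p := by exact_mod_cast (Fact.out : p.Prime).pos
  have hpos := excess_pos v B
  have hle := excess_anti v (empty_subset B)
  rw [excess_empty] at hle
  have hf0 : 0 ≤ (1 + excess v B) / p := by positivity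
  have hf1 : (1 + excess v B) / p ≤ 1 := by rw [div_le_one hp]; linarith
  refine (prob_orthRows_ge_le a v B q hf0 hf1 (prob_sum_eq_le v B)).trans ?_
  refine mul_le_mul_of_nonneg_left ?_ (Nat.cast_nonneg _)
  exact pow_le_pow_of_le_one hf0 hf1 (by omega)

lemma sum_sparse_le (hp : 2 < p) (a : ZMod p) (q m : ℕ) (V : Finset (Fin n → ZMod p))
    (h0 : ∀ v ∈ V, v ≠ 0) (hV : ∀ v ∈ V, ∃ B : Finset (Fin n), B.card ≤ m ∧ ∀ i ∉ B, v i = 0) :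
    ∑ v ∈ V, prob (nearKernelEvent a q v) ≤ numSmallSubsets n m *
      (p ^ m * (numSmallSubsets n q * (1 / 2) ^ (n - q - 1))) := by
  refine sum_le_card_mul_of_cover (univ.filter fun R : Finset (Fin n) => R.card ≤ m) id
    (fun B hB => (mem_filter.1 hB).2) _ (fun v => prob_nonneg _) V
    (fun B v => ∀ i ∉ B, v i = 0) (fun _ _ _ => {0}) (by positivity) ?_ ?_ ?_
  · intro v hv
    obtain ⟨B, hB, h⟩ := hV v hv
    exact ⟨B, by simpa using hB, h⟩
  · intro B _ v _ h i hi
    simpa using h i hi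
  · intro B _ v hv _
    obtain ⟨j, hj⟩ := Function.ne_iff.1 (h0 v hv)
    have := prob_orthRows_ge_le a v {j} q (by norm_num) (by norm_num)
      (prob_single_sign_le_half hp v hj)
    simpa [nearKernelEvent, numSmallSubsets] using this

/-- Vectors whose coordinates outside a small set `B` are all near values, with enough nonzero
coordinates for the near values not to reduce to `{0}`. The number of near values is a small
multiple of `1 / f`, where `f = (1 + excess v B) / p` bounds the probability that a given row is
orthogonal to `v`. -/
lemma sum_nearValues_le (hp : 2 < p) (a : ZMod p) (q m k : ℕ) (hqm : q + m ≤ n)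
    (V : Finset (Fin n → ZMod p))
    (hV : ∀ v ∈ V, ∃ B : Finset (Fin n), B.card ≤ m ∧ (∃ i ∉ B, v i ≠ 0) ∧
      ∀ i ∉ B, v i ∈ nearValues v B (1 / (2 * 4 ^ k))) :
    ∑ v ∈ V, prob (nearKernelEvent a q v) ≤ numSmallSubsets n m *
      (p ^ m * (numSmallSubsets n q * ((4 / 2 ^ k) ^ n * p ^ (q + m)))) := by
  have hp0 : (0 : ℝ) < p := by exact_mod_cast (Fact.out : p.Prime).pos
  have hcongr : ∀ (v : Fin n → ZMod p) (B : Finset (Fin n)) (δ : ℝ),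
      nearValues (B.piecewise v 0) B δ = nearValues v B δ := fun v B δ =>
    nearValues_congr (fun i hi => by simp [hi]) δ
  refine sum_le_card_mul_of_cover (univ.filter fun R : Finset (Fin n) => R.card ≤ m) id
    (fun B hB => (mem_filter.1 hB).2) _ (fun v => prob_nonneg _) V
    (fun B v => (∃ i ∉ B, v i ≠ 0) ∧ ∀ i ∉ B, v i ∈ nearValues v B (1 / (2 * 4 ^ k)))
    (fun B w _ => nearValues w B (1 / (2 * 4 ^ k))) (by positivity) ?_ ?_ ?_
  · intro v hv
    obtain ⟨B, hB, h⟩ := hV v hv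
    exact ⟨B, by simpa using hB, h⟩
  · intro B _ v _ h i hi
    simp only [id, hcongr]
    exact h.2 i hi
  · rintro B hB v hv ⟨⟨i, hi, hvi⟩, hnear⟩
    simp only [id, hcongr, prod_const]
    have hBm := (mem_filter.1 hB).2
    have hP := prob_nearKernelEvent_le a q m v B hBm
    have hA := card_nearValues_le hp v B k
    have hA2 : 2 ≤ (nearValues v B (1 / (2 * 4 ^ k))).card := by
      refine one_lt_card.2 ⟨v i, hnear i hi, 0, zero_mem_nearValues v B (by positivity), hvi⟩
    have hA2' : (2 : ℝ) ≤ (nearValues v B (1 / (2 * 4 ^ k))).card := by exact_mod_cast hA2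
    have hpos := excess_pos v B
    set A := ((nearValues v B (1 / (2 * 4 ^ k))).card : ℝ)
    set f := (1 + excess v B) / p with hf
    have hf0 : 0 < f := by positivity
    have hpf : p / (1 + excess v B) = 1 / f := by rw [hf, one_div_div]
    rw [hpf] at hA
    have hAf : A * f ≤ 4 / 2 ^ k := by
      have h1 : A ≤ 4 / 2 ^ k * (1 / f) := by
        have : 4 / 2 ^ k * (1 / f) = 2 * (2 / 2 ^ k * (1 / f)) := by ring
        linarith
      calc A * f ≤ 4 / 2 ^ k * (1 / f) * f := by gcongr
        _ = _ := by field_simp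
    have hpf1 : 1 ≤ p * f := by
      rw [hf, mul_div_cancel₀ _ hp0.ne']
      linarith
    have hcard : (univ \ B).card ≤ n := by
      simpa using card_le_univ (univ \ B)
    clear_value A f
    have hsplit : n = (n - q - m) + (q + m) := by omega
    calc prob (nearKernelEvent a q v) * A ^ (univ \ B).card
        ≤ numSmallSubsets n q * f ^ (n - q - m) * A ^ n := by
          gcongr
          linarith
      _ ≤ numSmallSubsets n q * f ^ (n - q - m) * A ^ n * (p * f) ^ (q + m) :=
          le_mul_of_one_le_right (by positivity) (one_le_pow₀ hpf1)
      _ = numSmallSubsets n q * ((A ^ n * (f ^ (n - q - m) * f ^ (q + m))) * p ^ (q + m)) := by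
          rw [mul_pow]; ring
      _ = numSmallSubsets n q * ((A * f) ^ n * p ^ (q + m)) := by
          rw [← pow_add, ← hsplit, mul_pow]
      _ ≤ _ := by gcongr

/-- Vectors with small excess on some set, for which each row is orthogonal with probability at
most `2 / p`, but whose coordinates in a large set `U` are confined to near values. -/
lemma sum_confined_le (hp : 2 < p) (a : ZMod p) (q m k r : ℕ) (hqm : q + m ≤ n)
    (hk : 2 ^ k ≤ 2 * p) (hk2 : 2 ≤ k) (V : Finset (Fin n → ZMod p))
    (hV1 : ∀ v ∈ V, ∃ B : Finset (Fin n), B.card ≤ m ∧ excess v B ≤ 1)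
    (hV : ∀ v ∈ V, ∃ U : Finset (Fin n), r + m ≤ U.card ∧ ∃ B : Finset (Fin n), B.card ≤ m ∧
      ∀ i ∈ U \ B, v i ∈ nearValues v B (1 / (2 * 4 ^ k))) :
    ∑ v ∈ V, prob (nearKernelEvent a q v) ≤ 2 ^ n * numSmallSubsets n m *
      (p ^ m * (numSmallSubsets n q * (2 ^ n * p ^ (q + m) * (4 / 2 ^ k) ^ r))) := by
  classical
  have hp0 : (0 : ℝ) < p := by exact_mod_cast (Fact.out : p.Prime).pos
  have hcongr : ∀ (v : Fin n → ZMod p) (B : Finset (Fin n)) (δ : ℝ),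
      nearValues (B.piecewise v 0) B δ = nearValues v B δ := fun v B δ =>
    nearValues_congr (fun i hi => by simp [hi]) δ
  let ℬ : Finset (Finset (Fin n) × Finset (Fin n)) :=
    (univ.filter fun U => r + m ≤ U.card) ×ˢ (univ.filter fun R => R.card ≤ m)
  have hℬ : (ℬ.card : ℝ) ≤ 2 ^ n * numSmallSubsets n m := by
    rw [card_product]
    push_cast
    refine mul_le_mul_of_nonneg_right ?_ (Nat.cast_nonneg _)
    have : (univ.filter fun U : Finset (Fin n) => r + m ≤ U.card).card ≤ 2 ^ n := by
      refine (card_le_univ _).trans ?_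
      simp
    exact_mod_cast this
  refine le_trans (sum_le_card_mul_of_cover ℬ Prod.snd
    (fun b hb => (mem_filter.1 (mem_product.1 hb).2).2) _ (fun v => prob_nonneg _) V
    (fun b v => ∀ i ∈ b.1 \ b.2, v i ∈ nearValues v b.2 (1 / (2 * 4 ^ k)))
    (fun b w i => if i ∈ b.1 then nearValues w b.2 (1 / (2 * 4 ^ k)) else univ)
    (X := numSmallSubsets n q * (2 ^ n * p ^ (q + m) * (4 / 2 ^ k) ^ r))
    (by positivity) ?_ ?_ ?_)
    (mul_le_mul_of_nonneg_right hℬ (by positivity))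
  · intro v hv
    obtain ⟨U, hU, B, hB, h⟩ := hV v hv
    exact ⟨(U, B), mem_product.2 ⟨by simpa using hU, by simpa using hB⟩, h⟩
  · rintro ⟨U, B⟩ _ v _ h i hi
    simp only [hcongr]
    split_ifs with hiU
    · exact h i (mem_sdiff.2 ⟨hiU, hi⟩)
    · exact mem_univ _
  · rintro ⟨U, B⟩ hb v hv h
    simp only [hcongr]
    have hBm : B.card ≤ m := (mem_filter.1 (mem_product.1 hb).2).2
    have hU : r + m ≤ U.card := (mem_filter.1 (mem_product.1 hb).1).2
    obtain ⟨B₁, hB₁, he⟩ := hV1 v hv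
    have hP : prob (nearKernelEvent a q v) ≤ numSmallSubsets n q * (2 / p) ^ (n - q - m) := by
      refine (prob_nearKernelEvent_le a q m v B₁ hB₁).trans ?_
      have := excess_pos v B₁
      gcongr
      linarith
    have hA : ((nearValues v B (1 / (2 * 4 ^ k))).card : ℝ) ≤ 4 / 2 ^ k * p := by
      refine (card_nearValues_le hp v B k).trans ?_
      have hpos := excess_pos v B
      have h1 : p / (1 + excess v B) ≤ p := div_le_self hp0.le (by linarith)
      have h2 : 2 / 2 ^ k * (p / (1 + excess v B)) ≤ 2 / 2 ^ k * p := by gcongr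
      have h3 : 1 ≤ 2 / 2 ^ k * (p : ℝ) := by
        rw [div_mul_eq_mul_div, one_le_div (by positivity)]
        exact_mod_cast hk
      have h4 : 4 / 2 ^ k * (p : ℝ) = 2 * (2 / 2 ^ k * p) := by ring
      linarith
    have hsmall : (4 : ℝ) / 2 ^ k ≤ 1 := by
      rw [div_le_one (by positivity)]
      calc (4 : ℝ) = 2 ^ 2 := by norm_num
        _ ≤ 2 ^ k := pow_le_pow_right₀ (by norm_num) hk2
    have hprod : ∏ i ∈ univ \ B, ((if i ∈ U then nearValues v B (1 / (2 * 4 ^ k))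
        else univ).card : ℝ) ≤ p ^ n * (4 / 2 ^ k) ^ r := by
      calc ∏ i ∈ univ \ B, ((if i ∈ U then nearValues v B (1 / (2 * 4 ^ k)) else univ).card : ℝ)
          ≤ ∏ i ∈ univ \ B, (p * if i ∈ U then (4 / 2 ^ k : ℝ) else 1) := by
            refine prod_le_prod (fun _ _ => Nat.cast_nonneg _) fun i _ => ?_
            split_ifs
            · linarith
            · simp [ZMod.card]
        _ = p ^ (univ \ B).card * (4 / 2 ^ k) ^ ((univ \ B).filter (· ∈ U)).card := by
            rw [prod_mul_distrib, prod_const, prod_ite, prod_const, prod_const_one, mul_one]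
        _ ≤ p ^ n * (4 / 2 ^ k) ^ r := by
            have h1 : (univ \ B).card ≤ n := by simpa using card_le_univ (univ \ B)
            have h2 : r ≤ ((univ \ B).filter (· ∈ U)).card := by
              have h3 : U \ B ⊆ (univ \ B).filter (· ∈ U) := by
                intro i hi
                rw [mem_sdiff] at hi
                simp [hi.1, hi.2]
              have h4 := card_le_card h3
              have h5 := le_card_sdiff B U
              omega
            have h6 : (1 : ℝ) ≤ p := by exact_mod_cast (Fact.out : p.Prime).one_le
            have h7 : (4 / 2 ^ k : ℝ) ^ ((univ \ B).filter (· ∈ U)).card ≤ (4 / 2 ^ k) ^ r :=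
              pow_le_pow_of_le_one (by positivity) hsmall h2
            gcongr
    have hsplit : (p : ℝ) ^ n = p ^ (n - q - m) * p ^ (q + m) := by
      rw [← pow_add]; congr 1; omega
    have hcancel : (2 / p : ℝ) ^ (n - q - m) * p ^ n = 2 ^ (n - q - m) * p ^ (q + m) := by
      rw [hsplit, div_pow, ← mul_assoc, div_mul_cancel₀ _ (pow_ne_zero _ hp0.ne')]
    have htwo : (2 : ℝ) ^ (n - q - m) ≤ 2 ^ n := pow_le_pow_right₀ (by norm_num) (by omega)
    calc _ ≤ (numSmallSubsets n q : ℝ) * (2 / p) ^ (n - q - m) * (p ^ n * (4 / 2 ^ k) ^ r) :=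
          mul_le_mul hP hprod (prod_nonneg fun _ _ => Nat.cast_nonneg _) (by positivity)
      _ = numSmallSubsets n q * ((2 / p : ℝ) ^ (n - q - m) * p ^ n * (4 / 2 ^ k) ^ r) := by ring
      _ ≤ _ := by
          rw [hcancel]
          refine mul_le_mul_of_nonneg_left ?_ (Nat.cast_nonneg _)
          refine mul_le_mul_of_nonneg_right ?_ (by positivity)
          exact mul_le_mul_of_nonneg_right htwo (by positivity)

end cases

end

/-! ### Numerical bounds and the union bound -/

section numerics

variable {n p q m r : ℕ}

lemma pow_le_exp_mul {x y : ℝ} (hx : 0 ≤ x) (h : x ≤ Real.exp y) (n : ℕ) :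
    x ^ n ≤ Real.exp (n * y) := by
  rw [Real.exp_nat_mul]
  exact pow_le_pow_left₀ hx h n

lemma six_mul_exp_le {x y : ℝ} (h : x + 5 ≤ y) : 6 * Real.exp x ≤ Real.exp y := by
  have h1 : (6 : ℝ) ≤ Real.exp 5 := by linarith [Real.add_one_le_exp (5 : ℝ)]
  calc 6 * Real.exp x ≤ Real.exp 5 * Real.exp x := by gcongr
    _ = Real.exp (5 + x) := (Real.exp_add _ _).symm
    _ ≤ Real.exp y := Real.exp_le_exp.2 (by linarith)

lemma natCast_pow_eq_exp (hp : 0 < p) (j : ℕ) : (p : ℝ) ^ j = Real.exp (j * Real.log p) := by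
  rw [Real.exp_nat_mul, Real.exp_log (by exact_mod_cast hp)]

lemma exp_four_le : Real.exp 4 ≤ 81 := by
  have h : Real.exp 4 = Real.exp 1 ^ 4 := by rw [← Real.exp_nat_mul]; norm_num
  rw [h]
  have h3 : Real.exp 1 ≤ 3 := by linarith [Real.exp_one_lt_d9]
  calc Real.exp 1 ^ 4 ≤ 3 ^ 4 := pow_le_pow_left₀ (Real.exp_pos 1).le h3 4
    _ = 81 := by norm_num

lemma sparse_bound_le (hp : 50 ≤ p) (hL : 30 ≤ Real.log p) (hq : q * Real.log p ≤ n)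
    (hm : m * Real.log p ≤ n / 1000) (hn : 1000 ≤ n) :
    numSmallSubsets n m * (p ^ m * (numSmallSubsets n q * (1 / 2) ^ (n - q - 1))) ≤
      Real.exp (-(n : ℝ) / 9) / 3 := by
  have hn' : (1000 : ℝ) ≤ n := by exact_mod_cast hn
  have hpm : (p : ℝ) ^ m ≤ Real.exp (n / 1000) := by
    rw [natCast_pow_eq_exp (by omega)]; exact Real.exp_le_exp.2 hm
  have hq30 : (q : ℝ) * 30 ≤ n := (mul_le_mul_of_nonneg_left hL (Nat.cast_nonneg q)).trans hq
  have hqn : q + 1 ≤ n := by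
    have h' : q * 30 ≤ n := by exact_mod_cast hq30
    omega
  have hNm : (numSmallSubsets n m : ℝ) ≤ (51 / 50) ^ n * Real.exp (n / 1000) := by
    have h := card_filter_card_le (ι := Fin n) m (y := 1 / 50) (by norm_num) (by norm_num)
    rw [Fintype.card_fin] at h
    refine h.trans (mul_le_mul (by norm_num) (le_trans ?_ hpm) (by positivity) (by positivity))
    refine pow_le_pow_left₀ (by norm_num) ?_ m
    norm_num
    exact hp
  have hNq : (numSmallSubsets n q : ℝ) ≤ (5 / 4) ^ n * 4 ^ q := by
    have h := card_filter_card_le (ι := Fin n) q (y := 1 / 4) (by norm_num) (by norm_num)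
    rw [Fintype.card_fin] at h
    norm_num at h
    exact h
  have h2 : (1 / 2 : ℝ) ^ (n - q - 1) = (1 / 2) ^ n * 2 ^ q * 2 := by
    have : n = (n - q - 1) + q + 1 := by omega
    nth_rewrite 2 [this]
    rw [pow_succ, pow_add]
    have h3 : (1 / 2 : ℝ) ^ q * 2 ^ q = 1 := by rw [← mul_pow]; norm_num
    linear_combination (-(1 / 2 : ℝ) ^ (n - q - 1)) * h3
  have h8 : (8 : ℝ) ^ q ≤ Real.exp (n / 10) := by
    have h : (8 : ℝ) ≤ Real.exp 3 := by
      have h : Real.exp 3 = Real.exp 1 ^ 3 := by rw [← Real.exp_nat_mul]; norm_num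
      have h2 : 2 ≤ Real.exp 1 := by linarith [Real.add_one_le_exp (1 : ℝ)]
      rw [h]
      calc (8 : ℝ) = 2 ^ 3 := by norm_num
        _ ≤ Real.exp 1 ^ 3 := pow_le_pow_left₀ (by norm_num) h2 3
    refine (pow_le_exp_mul (by norm_num) h q).trans (Real.exp_le_exp.2 ?_)
    linarith
  have h51 : (51 / 80 : ℝ) ^ n ≤ Real.exp (n * (-(29 / 80))) := by
    refine pow_le_exp_mul (by norm_num) ?_ n
    linarith [Real.add_one_le_exp (-(29 / 80) : ℝ)]
  have hmain : numSmallSubsets n m * (p ^ m * (numSmallSubsets n q * (1 / 2) ^ (n - q - 1))) ≤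
      2 * Real.exp (n * (-(29 / 80)) + n / 1000 + n / 1000 + n / 10) := by
    calc _ ≤ (51 / 50) ^ n * Real.exp (n / 1000) * (Real.exp (n / 1000) *
          ((5 / 4) ^ n * 4 ^ q * ((1 / 2) ^ n * 2 ^ q * 2))) := by
          rw [h2]; gcongr
      _ = 2 * ((51 / 80) ^ n * Real.exp (n / 1000) * Real.exp (n / 1000) * 8 ^ q) := by
          have e1 : (51 / 80 : ℝ) ^ n = (51 / 50) ^ n * (5 / 4) ^ n * (1 / 2) ^ n := by
            rw [← mul_pow, ← mul_pow]; norm_num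
          have e2 : (8 : ℝ) ^ q = 4 ^ q * 2 ^ q := by rw [← mul_pow]; norm_num
          rw [e1, e2]; ring
      _ ≤ 2 * (Real.exp (n * (-(29 / 80))) * Real.exp (n / 1000) * Real.exp (n / 1000) *
          Real.exp (n / 10)) := by gcongr
      _ = _ := by rw [Real.exp_add, Real.exp_add, Real.exp_add]
  have := six_mul_exp_le (x := n * (-(29 / 80)) + n / 1000 + n / 1000 + n / 10)
    (y := -(n : ℝ) / 9) (by linarith)
  linarith

lemma pow_add_le_exp (hp : 0 < p) (hq : q * Real.log p ≤ n)
    (hm : m * Real.log p ≤ n / 1000) : (p : ℝ) ^ (q + m) ≤ Real.exp (n + n / 1000) := by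
  rw [natCast_pow_eq_exp hp]
  refine Real.exp_le_exp.2 ?_
  push_cast
  linarith

lemma nearValues_bound_le (hp : 0 < p) (hq : q * Real.log p ≤ n)
    (hm : m * Real.log p ≤ n / 1000) (hn : 1000 ≤ n) :
    numSmallSubsets n m * (p ^ m *
      (numSmallSubsets n q * ((4 / 2 ^ 50) ^ n * p ^ (q + m)))) ≤
      Real.exp (-(n : ℝ) / 9) / 3 := by
  have hn' : (1000 : ℝ) ≤ n := by exact_mod_cast hn
  have hpm : (p : ℝ) ^ m ≤ Real.exp (n / 1000) := by
    rw [natCast_pow_eq_exp hp]; exact Real.exp_le_exp.2 hm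
  have hpqm := pow_add_le_exp hp hq hm
  have hconst : (2 * 2 * (4 / 2 ^ 50) : ℝ) ^ n ≤ Real.exp (n * (-4)) := by
    refine pow_le_exp_mul (by norm_num) ?_ n
    rw [Real.exp_neg, ← one_div, le_div_iff₀ (Real.exp_pos 4)]
    linarith [exp_four_le]
  have hmain : numSmallSubsets n m * (p ^ m *
      (numSmallSubsets n q * ((4 / 2 ^ 50) ^ n * p ^ (q + m)))) ≤
      Real.exp (n * (-4) + n / 1000 + (n + n / 1000)) := by
    calc _ ≤ (2 : ℝ) ^ n * (Real.exp (n / 1000) * (2 ^ n * ((4 / 2 ^ 50) ^ n *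
          Real.exp (n + n / 1000)))) := by
          have h1 := numSmallSubsets_le_two_pow n m
          have h2 := numSmallSubsets_le_two_pow n q
          gcongr
      _ = (2 * 2 * (4 / 2 ^ 50) : ℝ) ^ n * Real.exp (n / 1000) * Real.exp (n + n / 1000) := by
          rw [mul_pow, mul_pow]; ring
      _ ≤ Real.exp (n * (-4)) * Real.exp (n / 1000) * Real.exp (n + n / 1000) := by gcongr
      _ = _ := by rw [← Real.exp_add, ← Real.exp_add]
  have := six_mul_exp_le (x := n * (-4) + n / 1000 + (n + n / 1000))
    (y := -(n : ℝ) / 9) (by linarith)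
  linarith [Real.exp_pos (-(n : ℝ) / 9)]

lemma confined_bound_le (hp : 0 < p) (hq : q * Real.log p ≤ n)
    (hm : m * Real.log p ≤ n / 1000) (hn : 1000 ≤ n) (hr : n ≤ 6 * r) :
    2 ^ n * numSmallSubsets n m * (p ^ m *
      (numSmallSubsets n q * (2 ^ n * p ^ (q + m) * (4 / 2 ^ 50) ^ r))) ≤
      Real.exp (-(n : ℝ) / 9) / 3 := by
  have hn' : (1000 : ℝ) ≤ n := by exact_mod_cast hn
  have hpm : (p : ℝ) ^ m ≤ Real.exp (n / 1000) := by
    rw [natCast_pow_eq_exp hp]; exact Real.exp_le_exp.2 hm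
  have hpqm := pow_add_le_exp hp hq hm
  have hconst : (2 * 2 * 2 * 2 * (1 / 2 ^ 8) : ℝ) ^ n ≤ Real.exp (n * (-2)) := by
    refine pow_le_exp_mul (by norm_num) ?_ n
    have h : Real.exp 2 ≤ 9 := by
      have h4 : Real.exp 2 ^ 2 = Real.exp 4 := by rw [← Real.exp_nat_mul]; norm_num
      nlinarith [exp_four_le, Real.exp_pos 2]
    rw [Real.exp_neg, ← one_div, le_div_iff₀ (Real.exp_pos 2)]
    linarith
  have hpow : (4 / 2 ^ 50 : ℝ) ^ r ≤ (1 / 2 ^ 8) ^ n := by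
    have : (4 / 2 ^ 50 : ℝ) = (1 / 2 ^ 8) ^ 6 := by norm_num
    rw [this, ← pow_mul]
    exact pow_le_pow_of_le_one (by norm_num) (by norm_num) hr
  have hmain : 2 ^ n * numSmallSubsets n m * (p ^ m *
      (numSmallSubsets n q * (2 ^ n * p ^ (q + m) * (4 / 2 ^ 50) ^ r))) ≤
      Real.exp (n * (-2) + n / 1000 + (n + n / 1000)) := by
    calc _ ≤ (2 : ℝ) ^ n * 2 ^ n * (Real.exp (n / 1000) * (2 ^ n * (2 ^ n *
          Real.exp (n + n / 1000) * (1 / 2 ^ 8) ^ n))) := by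
          have h1 := numSmallSubsets_le_two_pow n m
          have h2 := numSmallSubsets_le_two_pow n q
          gcongr
      _ = (2 * 2 * 2 * 2 * (1 / 2 ^ 8) : ℝ) ^ n * Real.exp (n / 1000) *
          Real.exp (n + n / 1000) := by
          simp only [mul_pow]; ring
      _ ≤ Real.exp (n * (-2)) * Real.exp (n / 1000) * Real.exp (n + n / 1000) := by gcongr
      _ = _ := by rw [← Real.exp_add, ← Real.exp_add]
  have := six_mul_exp_le (x := n * (-2) + n / 1000 + (n + n / 1000))
    (y := -(n : ℝ) / 9) (by linarith)
  linarith [Real.exp_pos (-(n : ℝ) / 9)]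

end numerics

lemma disc_le_one {p : ℕ} [Fact p.Prime] {ι : Type*} [Fintype ι] [DecidableEq ι]
    (w : ι → ZMod p) : disc w ≤ 1 := by
  refine ciSup_le fun x => ?_
  have hp : (1 : ℝ) ≤ p := by exact_mod_cast (Fact.out : p.Prime).one_le
  have h1 : 1 / (p : ℝ) ≤ 1 := by rw [div_le_one (by linarith)]; exact hp
  have h2 : 0 ≤ 1 / (p : ℝ) := by positivity
  rw [abs_le]
  constructor
  · linarith [prob_nonneg {ξ : ι → ℤˣ | ∑ i, (((ξ i : ℤˣ) : ℤ) : ZMod p) * w i = x}]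
  · linarith [prob_le_one {ξ : ι → ℤˣ | ∑ i, (((ξ i : ℤˣ) : ℤ) : ZMod p) * w i = x}]

/-- The union bound over all vectors without many uniform blocks. -/
lemma sum_not_manyUniformBlocks_le {n p : ℕ} [Fact p.Prime] (hp : 2 ^ 50 ≤ p) (a : ZMod p)
    {C : ℝ} (hC : 1 ≤ C) {q m : ℕ} (hL : 30 ≤ Real.log p) (hq : q * Real.log p ≤ n)
    (hm : m * Real.log p ≤ n / 1000) (hn : 1000 ≤ n) (hmL : 2 ^ 104 * Real.log p ≤ m)
    (V : Finset (Fin n → ZMod p)) (hV : ∀ v ∈ V, v ≠ 0 ∧ ¬ ManyUniformBlocks C m v) :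
    ∑ v ∈ V, prob (nearKernelEvent a q v) ≤ Real.exp (-(n : ℝ) / 9) := by
  classical
  have hp2 : 2 < p := by omega
  have hp0 : (0 : ℝ) < p := by exact_mod_cast (Fact.out : p.Prime).pos
  have hp1 : (1 : ℝ) ≤ p := by exact_mod_cast (Fact.out : p.Prime).one_le
  have hm0 : 0 < m := by
    have : (0 : ℝ) < m := by linarith
    exact_mod_cast this
  have hq30 : q * 30 ≤ n := by
    have : (q : ℝ) * 30 ≤ n := (mul_le_mul_of_nonneg_left hL (Nat.cast_nonneg q)).trans hq
    exact_mod_cast this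
  have hm1000 : m * 1000 ≤ n := by
    have h1 : (m : ℝ) * 1 ≤ m * Real.log p := by gcongr; linarith
    have : (m : ℝ) * 1000 ≤ n := by linarith
    exact_mod_cast this
  set δ : ℝ := 1 / (2 * 4 ^ 50) with hδ
  have hδ4 : δ ≤ 4 := by rw [hδ]; norm_num
  -- `m` greedy steps shrink the excess from `p - 1` to `1 / p`, since `m * δ / 4 ≥ 2 log p`.
  have hdecay : (1 - δ / 4) ^ m * p ≤ 1 / p := by
    have h1 : (1 - δ / 4) ^ m ≤ Real.exp (m * (-(δ / 4))) := by
      refine pow_le_exp_mul (by linarith) ?_ m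
      linarith [Real.add_one_le_exp (-(δ / 4))]
    have h2 : (m : ℝ) * (-(δ / 4)) ≤ -(Real.log p) + -(Real.log p) := by
      rw [hδ]; norm_num at hmL ⊢; linarith
    have h3 : (1 - δ / 4) ^ m ≤ (p : ℝ)⁻¹ * (p : ℝ)⁻¹ := by
      refine h1.trans ((Real.exp_le_exp.2 h2).trans_eq ?_)
      rw [Real.exp_add, Real.exp_neg, Real.exp_log hp0]
    calc (1 - δ / 4) ^ m * p ≤ (p : ℝ)⁻¹ * (p : ℝ)⁻¹ * p := by gcongr
      _ = 1 / p := by rw [inv_mul_cancel_right₀ hp0.ne', one_div]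
  let sparse : (Fin n → ZMod p) → Prop := fun v =>
    ∃ B : Finset (Fin n), B.card ≤ m ∧ ∀ i ∉ B, v i = 0
  let near : (Fin n → ZMod p) → Prop := fun v =>
    ∃ B : Finset (Fin n), B.card ≤ m ∧ ∀ i ∉ B, v i ∈ nearValues v B δ
  rw [← sum_filter_add_sum_filter_not V sparse,
    ← sum_filter_add_sum_filter_not (V.filter fun v => ¬ sparse v) near]
  have h1 := (sum_sparse_le hp2 a q m (V.filter sparse)
    (fun v hv => (hV v (mem_filter.1 hv).1).1) (fun v hv => (mem_filter.1 hv).2)).trans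
    (sparse_bound_le (by omega) hL hq hm hn)
  have h2 := (sum_nearValues_le hp2 a q m 50 (by omega)
    ((V.filter fun v => ¬ sparse v).filter near) (fun v hv => by
      obtain ⟨hv, B, hB, hnear⟩ := mem_filter.1 hv
      refine ⟨B, hB, ?_, hnear⟩
      have hns := (mem_filter.1 hv).2
      by_contra hcon
      push Not at hcon
      exact hns ⟨B, hB, hcon⟩)).trans
    (nearValues_bound_le (by omega) hq hm hn)
  have h3 := (sum_confined_le hp2 a q m 50 ((n + 5) / 6) (by omega) (by omega) (by norm_num)
    ((V.filter fun v => ¬ sparse v).filter fun v => ¬ near v)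
    (fun v hv => by
      obtain ⟨B, -, hB, hexc, h⟩ := exists_greedy_subset v univ m hδ4
      refine ⟨B, hB, ?_⟩
      rcases h with h | h
      · rw [h] at hexc
        refine (hexc.trans hdecay).trans ?_
        rw [div_le_one hp0]
        exact hp1
      · exact absurd ⟨B, hB, fun i hi => h i (by simpa using hi)⟩ (mem_filter.1 hv).2)
    (fun v hv => by
      have hv' := hV v (mem_filter.1 (mem_filter.1 hv).1).1
      obtain ⟨U, hU, hbad⟩ := exists_large_set_of_not_manyUniformBlocks hm0 (by omega) hv'.2
      obtain ⟨B, hBU, hB, hexc, h⟩ := exists_greedy_subset v U m hδ4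
      refine ⟨U, by omega, B, hB, ?_⟩
      rcases h with h | h
      · exfalso
        have hlt := hbad B hBU h
        rw [h] at hexc
        have h4 := disc_le_excess_div v B
        have h5 : excess v B / p ≤ C / (p : ℝ) ^ 2 := by
          calc excess v B / p ≤ (1 / p) / p := by gcongr; exact hexc.trans hdecay
            _ = 1 / (p : ℝ) ^ 2 := by rw [div_div, sq]
            _ ≤ C / (p : ℝ) ^ 2 := by gcongr
        linarith
      · exact h)).trans
    (confined_bound_le (by omega) hq hm hn (by omega))
  linarith

end SymRademacher

theorem proposition2p5 :
    ∃ c : ℝ, 0 < c ∧ ∃ C : ℝ, 0 < C ∧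
      ∀ (n p : ℕ), p.Prime → 2 < p → (p : ℝ) ≤ Real.exp (c * (n : ℝ) ^ (1 / 4 : ℝ)) →
        ∀ a : ZMod p,
          1 - Real.exp (-(n : ℝ) / 9) ≤
            SymRademacher.prob {ω : Sym2 (Fin n) → ℤˣ |
              ∀ v : Fin n → ZMod p, v ≠ 0 →
                (n : ℝ) - (n : ℝ) / Real.log p ≤
                  (SymRademacher.orthRows (SymRademacher.shiftedMatrix p a ω) v : ℝ) →
                SymRademacher.ManyUniformBlocks C ⌈C * Real.log p⌉₊ v} := by
  classical
  -- Near values are taken with parameter `δ = 1 / (2 * 4 ^ 50) = 2 ^ (-101)`, and `C * δ / 4 = 2`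
  -- makes `m` greedy steps bring the excess from `p` down to `1 / p`. The choice of `c` makes
  -- `m * log p`, of order `C * c ^ 2 * n ^ (1 / 2)`, negligible against `n`.
  refine ⟨1 / 2 ^ 60, by positivity, 2 ^ 104, by positivity, fun n p hp hp2 hpn a => ?_⟩
  have : Fact p.Prime := ⟨hp⟩
  set E := {ω : Sym2 (Fin n) → ℤˣ |
              ∀ v : Fin n → ZMod p, v ≠ 0 →
                (n : ℝ) - (n : ℝ) / Real.log p ≤
                  (SymRademacher.orthRows (SymRademacher.shiftedMatrix p a ω) v : ℝ) →
                SymRademacher.ManyUniformBlocks (2 ^ 104) ⌈2 ^ 104 * Real.log p⌉₊ v} with hE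
  set L := Real.log p with hLdef
  set m := ⌈2 ^ 104 * L⌉₊ with hm
  have hp0 : (0 : ℝ) < p := by exact_mod_cast hp.pos
  have hp3 : (3 : ℝ) ≤ p := by exact_mod_cast hp2
  have hL1 : 1 ≤ L := by
    rw [hLdef, Real.le_log_iff_exp_le hp0]
    linarith [Real.exp_one_lt_d9]
  set y := (n : ℝ) ^ (1 / 4 : ℝ) with hy
  have hy0 : 0 ≤ y := Real.rpow_nonneg (Nat.cast_nonneg n) _
  have hy4 : y ^ 4 = n := by
    rw [hy, ← Real.rpow_natCast, ← Real.rpow_mul (Nat.cast_nonneg n)]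
    norm_num
  have hLy : 2 ^ 60 * L ≤ y := by
    have h : L ≤ 1 / 2 ^ 60 * y := by
      rw [hLdef, Real.log_le_iff_le_exp hp0]; exact hpn
    calc 2 ^ 60 * L ≤ 2 ^ 60 * (1 / 2 ^ 60 * y) := by gcongr
      _ = y := by ring
  have hy60 : 2 ^ 60 ≤ y := by linarith
  have hn : (2 : ℝ) ^ 240 ≤ n := by
    rw [← hy4]
    calc (2 : ℝ) ^ 240 = (2 ^ 60) ^ 4 := by norm_num
      _ ≤ y ^ 4 := by gcongr
  have hn1000 : 1000 ≤ n := by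
    have : (1000 : ℝ) ≤ n := le_trans (by norm_num) hn
    exact_mod_cast this
  have hmL : 2 ^ 104 * L ≤ m := Nat.le_ceil _
  have hm0 : 0 < m := by
    have : (0 : ℝ) < m := by linarith
    exact_mod_cast this
  have hmn : m * L ≤ n / 1000 := by
    have h1 : (m : ℝ) ≤ 2 ^ 105 * L := by
      have := Nat.ceil_lt_add_one (a := 2 ^ 104 * L) (by positivity)
      rw [← hm] at this
      linarith
    have h2 : m * L ≤ 2 ^ 105 * (L * L) := by
      rw [← mul_assoc]; gcongr
    have h3 : (2 ^ 60 * L) * (2 ^ 60 * L) ≤ y * y := by gcongr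
    have h4 : 1 ≤ y * y := by nlinarith
    have h5 : (n : ℝ) = (y * y) * (y * y) := by rw [← hy4]; ring
    have h6 : y * y ≤ n := by rw [h5]; nlinarith
    linarith
  have hcompl : SymRademacher.prob Eᶜ ≤ Real.exp (-(n : ℝ) / 9) := by
    by_cases hpC : (p : ℝ) ^ 2 ≤ 2 ^ 104
    · -- For bounded `p` the bound `C / p²` on the discrepancy is trivial.
      have hempty : Eᶜ = ∅ := by
        rw [Set.compl_empty_iff, Set.eq_univ_iff_forall]
        intro ω v _ _
        by_contra hcon
        obtain ⟨U, hU, hbad⟩ := SymRademacher.exists_large_set_of_not_manyUniformBlocks hm0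
          (by omega) hcon
        have hmU : m ≤ U.card := by
          have h1 : (m : ℝ) * 1 ≤ m * L := by gcongr
          have h2 : (m : ℝ) * 1000 ≤ n := by linarith
          have h3 : m * 1000 ≤ n := by exact_mod_cast h2
          omega
        obtain ⟨S, hSU, hS⟩ := Finset.exists_subset_card_eq hmU
        have h1 := hbad S hSU hS
        have h2 := SymRademacher.disc_le_one (fun i : S => v i)
        have h3 : 1 ≤ 2 ^ 104 / (p : ℝ) ^ 2 := by
          rw [one_le_div (by positivity)]; exact hpC
        linarith
      rw [hempty]
      simpa [SymRademacher.prob] using (Real.exp_pos (-(n : ℝ) / 9)).le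
    · have hp52 : (2 : ℝ) ^ 52 < p := by
        refine lt_of_pow_lt_pow_left₀ 2 hp0.le ?_
        linarith
      have hp50 : 2 ^ 50 ≤ p := by
        have : (2 : ℝ) ^ 50 ≤ p := by linarith
        exact_mod_cast this
      have hL30 : 30 ≤ L := by
        have h1 : Real.log (2 ^ 52) ≤ L := Real.log_le_log (by positivity) hp52.le
        rw [Real.log_pow] at h1
        have := Real.log_two_gt_d9
        push_cast at h1
        linarith
      have hqL : (⌊n / L⌋₊ : ℝ) * L ≤ n := by
        rw [← le_div_iff₀ (by linarith)]
        exact Nat.floor_le (by positivity)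
      let V : Finset (Fin n → ZMod p) := Finset.univ.filter fun v =>
        v ≠ 0 ∧ ¬ SymRademacher.ManyUniformBlocks (2 ^ 104) m v
      have hsub : Eᶜ ⊆ ⋃ v ∈ V, SymRademacher.nearKernelEvent a ⌊n / L⌋₊ v := by
        intro ω hω
        rw [Set.mem_compl_iff, hE, Set.mem_ofPred_eq] at hω
        push Not at hω
        obtain ⟨v, hv0, hv, hbad⟩ := hω
        simp only [Set.mem_iUnion, exists_prop]
        refine ⟨v, by simp [V, hv0, hbad], ?_⟩
        have h : n - SymRademacher.orthRows (SymRademacher.shiftedMatrix p a ω) v ≤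
            ⌊n / L⌋₊ := by
          refine Nat.le_floor ?_
          rcases le_total (SymRademacher.orthRows (SymRademacher.shiftedMatrix p a ω) v) n
            with h | h
          · rw [Nat.cast_sub h]; linarith
          · rw [Nat.sub_eq_zero_of_le h]; simp; positivity
        change n ≤ _ + _
        omega
      refine (SymRademacher.prob_mono hsub).trans ((SymRademacher.prob_biUnion_le _ _).trans ?_)
      exact SymRademacher.sum_not_manyUniformBlocks_le hp50 a (by norm_num) hL30 hqL hmn hn1000
        hmL V fun v hv => (Finset.mem_filter.1 hv).2
  rw [SymRademacher.prob_compl] at hcompl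
  linarith
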